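/- **Conventions.** Let ${\bf k}$ be a field of characteristic zero; $\otimes=\otimes_{\bf k}$, and maps are composed from right to left. A *braiding* on a vector space $M$ is a linear map $\tau:M\otimes M\to M\otimes M$, not necessarily invertible, with $$\tau_1\tau_2\tau_1=\tau_2\tau_1\tau_2,\qquad \tau_1=\tau\otimes\mathrm{id},\quad \tau_2=\mathrm{id}\otimes\tau .$$ A *braided algebra* is a unital, not necessarily associative algebra $A$ with multiplication $\mathbf m$ and a braiding $\tau$ such that $\tau(1\otimes a)=a\otimes 1$ and $\tau(a\otimes 1)=1\otimes a$ for all $a\in A$, and $$\tau(\mathbf m\otimes\mathrm{id})=(\mathrm{id}\otimes\mathbf m)\tau_1\tau_2,\qquad \tau(\mathrm{id}\otimes\mathbf m)=(\mathbf m\otimes\mathrm{id})\tau_2\tau_1 .$$ Then $A\underline{\otimes}A$ denotes the space $A\otimes A$ with the multiplication $(a\otimes b)(c\otimes d)=\sum_i ac_i\otimes b_id$, where $\tau(b\otimes c)=\sum_i c_i\otimes b_i$. A *braided nonassociative Hopf algebra structure* on a braided algebra $(A,\tau)$ consists of a linear coproduct $\Delta:A\to A\otimes A$, a linear counit $\varepsilon:A\to{\bf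 k}$ and bilinear left and right divisions $\backslash,\ /:A\times A\to A$ such that: * $\Delta$ is coassociative and $(\varepsilon\otimes\mathrm{id})\Delta=\mathrm{id}=(\mathrm{id}\otimes\varepsilon)\Delta$; * $(\varepsilon\otimes\mathrm{id})\tau(a\otimes b)=\varepsilon(b)a$ and $(\mathrm{id}\otimes\varepsilon)\tau(a\otimes b)=\varepsilon(a)b$ for all $a,b\in A$; * $(\mathrm{id}\otimes\Delta)\tau=\tau_1\tau_2(\Delta\otimes\mathrm{id})$ and $(\Delta\otimes\mathrm{id})\tau=\tau_2\tau_1(\mathrm{id}\otimes\Delta)$; * $\Delta:A\to A\underline{\otimes}A$ and $\varepsilon:A\to{\bf k}$ are homomorphisms of unital algebras; * for all $x,y\in A$, writing $\Delta(x)=\sum x_{(1)}\otimes x_{(2)}$, $$\sum x_{(1)}\backslash(x_{(2)}y)=\varepsilon(x)y=\sum x_{(1)}(x_{(2)}\backslash y),\qquad \sum (yx_{(1)})/x_{(2)}=\varepsilon(x)y=\sum (y/x_{(1)})x_{(2)} .$$ An element $a$ is *primitive* if $\Delta(a)=a\otimes 1+1\otimes a$. **Theorem 5.1.** Let $V$ be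 a vector space over ${\bf k}$ with a braiding $\tau$, let $X$ be a basis of $V$, and let ${\bf k}\{X\}$ be the free unital nonassociative algebra on $X$, with $V\subset{\bf k}\{X\}$ the span of the generators. Then $\tau$ has a unique extension $\tau^*$ to a braiding on ${\bf k}\{X\}$ that makes ${\bf k}\{X\}$ a braided algebra. On the braided algebra $({\bf k}\{X\},\tau^*)$ there is exactly one structure of braided nonassociative Hopf algebra $(\Delta,\varepsilon,\backslash,/)$ for which all elements of $X$ are primitive. -/

import Mathlib

open scoped TensorProduct

noncomputable section

namespace BraidedNA

section Braidings

variable {k : Type*} [CommSemiring k] {M : Type*} [AddCommMonoid M] [Module k M]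

/-- The operator `τ ⊗ id` on `M ⊗ M ⊗ M`. -/
def braid1 (τ : M ⊗[k] M →ₗ[k] M ⊗[k] M) :
    (M ⊗[k] M) ⊗[k] M →ₗ[k] (M ⊗[k] M) ⊗[k] M :=
  τ.rTensor M

/-- The operator `id ⊗ τ` on `M ⊗ M ⊗ M` (bracketed to the left). -/
def braid2 (τ : M ⊗[k] M →ₗ[k] M ⊗[k] M) :
    (M ⊗[k] M) ⊗[k] M →ₗ[k] (M ⊗[k] M) ⊗[k] M :=
  (TensorProduct.assoc k M M M).symm.toLinearMap ∘ₗ τ.lTensor M ∘ₗ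
    (TensorProduct.assoc k M M M).toLinearMap

/-- A braiding: a linear map satisfying the braid relation. It need not be invertible. -/
def IsBraiding (τ : M ⊗[k] M →ₗ[k] M ⊗[k] M) : Prop :=
  braid1 τ ∘ₗ braid2 τ ∘ₗ braid1 τ = braid2 τ ∘ₗ braid1 τ ∘ₗ braid2 τ

end Braidings

section Algebras

variable (k : Type*) [CommSemiring k] {A : Type*} [NonAssocSemiring A] [Module k A]
  [IsScalarTower k A A] [SMulCommClass k A A]

/-- A unital, not necessarily associative algebra with a braiding that is compatible with the
multiplication and with the unit. -/
structure IsBraidedAlgebra (τ : A ⊗[k] A →ₗ[k] A ⊗[k] A) : Prop where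
  braid : IsBraiding τ
  one_tmul : ∀ a : A, τ (1 ⊗ₜ[k] a) = a ⊗ₜ[k] 1
  tmul_one : ∀ a : A, τ (a ⊗ₜ[k] 1) = 1 ⊗ₜ[k] a
  /-- `τ (ab ⊗ c) = (id ⊗ m) (τ ⊗ id) (id ⊗ τ) (a ⊗ b ⊗ c)`. -/
  mul_left : τ ∘ₗ (LinearMap.mul' k A).rTensor A =
    (LinearMap.mul' k A).lTensor A ∘ₗ (TensorProduct.assoc k A A A).toLinearMap ∘ₗ
      braid1 τ ∘ₗ braid2 τ
  /-- `τ (a ⊗ bc) = (m ⊗ id) (id ⊗ τ) (τ ⊗ id) (a ⊗ b ⊗ c)`. -/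
  mul_right : τ ∘ₗ (LinearMap.mul' k A).lTensor A ∘ₗ (TensorProduct.assoc k A A A).toLinearMap =
    (LinearMap.mul' k A).rTensor A ∘ₗ braid2 τ ∘ₗ braid1 τ

variable {k}

/-- The multiplication of the braided tensor square of `A`:
`(a ⊗ b) (c ⊗ d) = ∑ a cᵢ ⊗ bᵢ d`, where `τ (b ⊗ c) = ∑ cᵢ ⊗ bᵢ`. -/
def braidedMul (τ : A ⊗[k] A →ₗ[k] A ⊗[k] A) :
    (A ⊗[k] A) ⊗[k] (A ⊗[k] A) →ₗ[k] A ⊗[k] A :=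
  TensorProduct.map (LinearMap.mul' k A) (LinearMap.mul' k A) ∘ₗ
    (TensorProduct.tensorTensorTensorAssoc k A A A A).symm.toLinearMap ∘ₗ
    (τ.lTensor A).rTensor A ∘ₗ
    (TensorProduct.tensorTensorTensorAssoc k A A A A).toLinearMap

variable (k A) in
/-- The structures of braided nonassociative Hopf algebra on the algebra `A` with the braiding `τ`.
The coproduct, the counit, coassociativity and the counit laws are those of `Coalgebra k A`. -/
structure BraidedHopfStructure (τ : A ⊗[k] A →ₗ[k] A ⊗[k] A) extends Coalgebra k A where
  braidedAlgebra : IsBraidedAlgebra k τ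
  /-- `(ε ⊗ id) (τ (a ⊗ b)) = ε(b) a`. -/
  counit_braid_left : ∀ a b : A,
    TensorProduct.lid k A (counit.rTensor A (τ (a ⊗ₜ[k] b))) = counit b • a
  /-- `(id ⊗ ε) (τ (a ⊗ b)) = ε(a) b`. -/
  counit_braid_right : ∀ a b : A,
    TensorProduct.rid k A (counit.lTensor A (τ (a ⊗ₜ[k] b))) = counit a • b
  /-- `(id ⊗ Δ) τ = (τ ⊗ id) (id ⊗ τ) (Δ ⊗ id)`. -/
  comul_braid_right : comul.lTensor A ∘ₗ τ =
    (TensorProduct.assoc k A A A).toLinearMap ∘ₗ braid1 τ ∘ₗ braid2 τ ∘ₗ comul.rTensor A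
  /-- `(Δ ⊗ id) τ = (id ⊗ τ) (τ ⊗ id) (id ⊗ Δ)`. -/
  comul_braid_left : comul.rTensor A ∘ₗ τ =
    braid2 τ ∘ₗ braid1 τ ∘ₗ (TensorProduct.assoc k A A A).symm.toLinearMap ∘ₗ comul.lTensor A
  comul_one : comul 1 = 1 ⊗ₜ[k] 1
  comul_mul : ∀ x y : A, comul (x * y) = braidedMul τ (comul x ⊗ₜ[k] comul y)
  counit_one : counit 1 = 1
  counit_mul : ∀ x y : A, counit (x * y) = counit x * counit y
  /-- The left division, `ldiv x y = x \ y`. -/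
  ldiv : A →ₗ[k] A →ₗ[k] A
  /-- The right division, `rdiv x y = x / y`. -/
  rdiv : A →ₗ[k] A →ₗ[k] A
  /-- `∑ x₁ \ (x₂ y) = ε(x) y`. -/
  ldiv_mul : ∀ x y : A,
    TensorProduct.lift (ldiv.compl₂ (LinearMap.mulRight k y)) (comul x) = counit x • y
  /-- `∑ x₁ (x₂ \ y) = ε(x) y`. -/
  mul_ldiv : ∀ x y : A,
    TensorProduct.lift ((LinearMap.mul k A).compl₂ (ldiv.flip y)) (comul x) = counit x • y
  /-- `∑ (y x₁) / x₂ = ε(x) y`. -/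
  mul_rdiv : ∀ x y : A,
    TensorProduct.lift (rdiv ∘ₗ LinearMap.mulLeft k y) (comul x) = counit x • y
  /-- `∑ (y / x₁) x₂ = ε(x) y`. -/
  rdiv_mul : ∀ x y : A,
    TensorProduct.lift (LinearMap.mul k A ∘ₗ rdiv y) (comul x) = counit x • y

/-- Primitive elements: `Δ(a) = a ⊗ 1 + 1 ⊗ a`. -/
def BraidedHopfStructure.IsPrimitive {τ : A ⊗[k] A →ₗ[k] A ⊗[k] A}
    (H : BraidedHopfStructure k A τ) (a : A) : Prop :=
  H.comul a = a ⊗ₜ[k] 1 + 1 ⊗ₜ[k] a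

end Algebras

section Free

variable (k : Type*) [Field k] (X : Type*)

/-- The free unital nonassociative algebra on `X`: its basis consists of the nonassociative
words in `X`, including the empty word `1`. -/
abbrev FreeNonassocAlgebra : Type _ := MonoidAlgebra k (WithOne (FreeMagma X))

variable {X} in
/-- The generators of the free nonassociative algebra. -/
def gen (x : X) : FreeNonassocAlgebra k X :=
  MonoidAlgebra.single (FreeMagma.of x : WithOne (FreeMagma X)) 1

variable {k X} {V : Type*} [AddCommGroup V] [Module k V]

/-- The inclusion of a vector space with basis `X` as the span of the generators. -/
def incl (b : Module.Basis X k V) : V →ₗ[k] FreeNonassocAlgebra k X :=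
  b.constr k (gen k)

/-- `σ` makes the free nonassociative algebra a braided algebra, and it extends the braiding `τ`
of the space of generators. -/
structure IsBraidedExtension (b : Module.Basis X k V) (τ : V ⊗[k] V →ₗ[k] V ⊗[k] V)
    (σ : FreeNonassocAlgebra k X ⊗[k] FreeNonassocAlgebra k X →ₗ[k]
      FreeNonassocAlgebra k X ⊗[k] FreeNonassocAlgebra k X) : Prop where
  braidedAlgebra : IsBraidedAlgebra k σ
  extends_braiding : σ ∘ₗ TensorProduct.map (incl b) (incl b) =
    TensorProduct.map (incl b) (incl b) ∘ₗ τ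

end Free

end BraidedNA

end

namespace BraidedNA

/-! ### Crossings of an algebra with a module, their naturality and their tensor products. -/

section HalfBraidings

variable {k : Type*} [CommSemiring k] {A : Type*} [NonAssocSemiring A] [Module k A]
  {V : Type*} [AddCommMonoid V] [Module k V]
  {P : Type*} [AddCommMonoid P] [Module k P] {Q : Type*} [AddCommMonoid Q] [Module k Q]

/-! Everything is propagated from generators by universal properties, although associativity is not
available. With one argument fixed, a multiplicative braiding is a "crossing" of `A` past a module
`P`. Crossings are the unital homomorphisms from `A` to `Hom(P, A ⊗ P)` or `Hom(P, P ⊗ A)` with a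
Kleisli-type product, so on the free algebra they can be prescribed arbitrarily on generators
(`exists_rightCrossing`, `exists_leftCrossing`). A linear map commuting with crossings on generators
commutes with them everywhere (`IsRightCrossing.natural`, `IsLeftCrossing.natural`).

The extension of `τ` is built in two stages: first the mixed braidings of `V` with `A`, then the
braiding of `A` with itself. Compatibility with products in the remaining argument is naturality
along the multiplication (`isMulBraiding_of_crossing`). The braid relation is reduced to generators
in the first, last and middle slots in turn (`IsMulBraiding.isBraiding`). Uniqueness holds because
each stage is determined on generators.

The coproduct is the unital homomorphism to the braided tensor square that makes the generators
primitive, and the counit is the augmentation killing them. Compatibility with the braiding rests on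
the braid relation (`IsMulBraiding.squareCrossRight_braidedMul` and its mirror image). It makes `Δ ⊗
id` and `id ⊗ Δ` multiplicative, so coassociativity and the counit laws also need checking only on
generators.

The divisions are convolution inverses of left and right multiplication in `Hom(A, End A)` and
`Hom(A, (End A)ᵐᵒᵖ)`. These algebras are associative even though `A` is not, hence uniqueness. For
existence, `Δ` preserves word length, and multiplication by the only word of length zero is the
identity, so a locally finite geometric series inverts (`exists_conv_inverse`). Length is preserved
because `Δ` commutes with the endomorphism doubling the generators, whose eigenvalues `2 ^ n` are
distinct in characteristic zero. -/

theorem rTensor_lTensor_apply {M N P Q : Type*} [AddCommMonoid M] [AddCommMonoid N]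
    [AddCommMonoid P] [AddCommMonoid Q] [Module k M] [Module k N] [Module k P] [Module k Q]
    (f : M →ₗ[k] N) (g : P →ₗ[k] Q) (t : M ⊗[k] P) :
    f.rTensor Q (g.lTensor M t) = g.lTensor N (f.rTensor P t) := by
  rw [← LinearMap.comp_apply, ← LinearMap.comp_apply, LinearMap.rTensor_comp_lTensor,
    LinearMap.lTensor_comp_rTensor]

/-- `ι : V → A` generates the unital nonassociative algebra `A`. -/
def Generates (ι : V →ₗ[k] A) : Prop :=
  ∀ S : Submodule k A, 1 ∈ S → (∀ v, ι v ∈ S) → (∀ a ∈ S, ∀ b ∈ S, a * b ∈ S) → ∀ a, a ∈ S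

/-- Two linear maps that agree on the generators and whose agreement propagates to products are
equal. -/
theorem Generates.linearMap_ext {ι : V →ₗ[k] A} (hι : Generates ι) {F G : A →ₗ[k] P}
    (one : F 1 = G 1) (gen : ∀ v, F (ι v) = G (ι v))
    (mul : ∀ a b, F a = G a → F b = G b → F (a * b) = G (a * b)) : F = G := by
  ext a
  exact hι (LinearMap.eqLocus F G) one gen (fun a ha b hb => mul a b ha hb) a

/-- The map `p ⊗ (a ⊗ q) ↦ ρ_a(p) ⊗ q`. -/
noncomputable def slideRight (ρ : A →ₗ[k] P →ₗ[k] A ⊗[k] P) :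
    P ⊗[k] (A ⊗[k] Q) →ₗ[k] A ⊗[k] (P ⊗[k] Q) :=
  (TensorProduct.assoc k A P Q).toLinearMap ∘ₗ
    (TensorProduct.lift ρ.flip).rTensor Q ∘ₗ (TensorProduct.assoc k P A Q).symm.toLinearMap

/-- The map `(q ⊗ a) ⊗ p ↦ q ⊗ ρ_a(p)`. -/
noncomputable def slideLeft (ρ : A →ₗ[k] P →ₗ[k] P ⊗[k] A) :
    (Q ⊗[k] A) ⊗[k] P →ₗ[k] (Q ⊗[k] P) ⊗[k] A :=
  (TensorProduct.assoc k Q P A).symm.toLinearMap ∘ₗ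
    (TensorProduct.lift ρ).lTensor Q ∘ₗ (TensorProduct.assoc k Q A P).toLinearMap

@[simp]
theorem slideRight_tmul (ρ : A →ₗ[k] P →ₗ[k] A ⊗[k] P) (p : P) (a : A) (q : Q) :
    slideRight ρ (p ⊗ₜ (a ⊗ₜ q)) = TensorProduct.assoc k A P Q (ρ a p ⊗ₜ q) := by
  simp [slideRight]

@[simp]
theorem slideLeft_tmul (ρ : A →ₗ[k] P →ₗ[k] P ⊗[k] A) (p : P) (a : A) (q : Q) :
    slideLeft ρ ((q ⊗ₜ a) ⊗ₜ p) = (TensorProduct.assoc k Q P A).symm (q ⊗ₜ ρ a p) := by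
  simp [slideLeft]

/-- The product of two right crossings, `p ⊗ q ⊗ a ↦ a'' ⊗ p' ⊗ q'`. -/
noncomputable def crossTensorRight (ρ : A →ₗ[k] P →ₗ[k] A ⊗[k] P)
    (ρ' : A →ₗ[k] Q →ₗ[k] A ⊗[k] Q) : A →ₗ[k] P ⊗[k] Q →ₗ[k] A ⊗[k] (P ⊗[k] Q) :=
  LinearMap.llcomp k _ _ _ (slideRight ρ) ∘ₗ LinearMap.lTensorHom P ∘ₗ ρ'

/-- The product of two left crossings, `a ⊗ q ⊗ p ↦ q' ⊗ p' ⊗ a''`. -/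
noncomputable def crossTensorLeft (ρ : A →ₗ[k] P →ₗ[k] P ⊗[k] A)
    (ρ' : A →ₗ[k] Q →ₗ[k] Q ⊗[k] A) : A →ₗ[k] Q ⊗[k] P →ₗ[k] (Q ⊗[k] P) ⊗[k] A :=
  LinearMap.llcomp k _ _ _ (slideLeft ρ) ∘ₗ LinearMap.rTensorHom P ∘ₗ ρ'

@[simp]
theorem crossTensorRight_tmul (ρ : A →ₗ[k] P →ₗ[k] A ⊗[k] P) (ρ' : A →ₗ[k] Q →ₗ[k] A ⊗[k] Q)
    (a : A) (p : P) (q : Q) :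
    crossTensorRight ρ ρ' a (p ⊗ₜ q) = slideRight ρ (p ⊗ₜ ρ' a q) := rfl

@[simp]
theorem crossTensorLeft_tmul (ρ : A →ₗ[k] P →ₗ[k] P ⊗[k] A) (ρ' : A →ₗ[k] Q →ₗ[k] Q ⊗[k] A)
    (a : A) (p : P) (q : Q) :
    crossTensorLeft ρ ρ' a (q ⊗ₜ p) = slideLeft ρ (ρ' a q ⊗ₜ p) := rfl

variable [IsScalarTower k A A] [SMulCommClass k A A]

/-- The extension `a ⊗ p ↦ a g(p)` of a linear map `g : P → A ⊗ Q`. -/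
noncomputable def extendLeft (g : P →ₗ[k] A ⊗[k] Q) : A ⊗[k] P →ₗ[k] A ⊗[k] Q :=
  (LinearMap.mul' k A).rTensor Q ∘ₗ (TensorProduct.assoc k A A Q).symm.toLinearMap ∘ₗ g.lTensor A

/-- The extension `p ⊗ a ↦ g(p) a` of a linear map `g : P → Q ⊗ A`. -/
noncomputable def extendRight (g : P →ₗ[k] Q ⊗[k] A) : P ⊗[k] A →ₗ[k] Q ⊗[k] A :=
  (LinearMap.mul' k A).lTensor Q ∘ₗ (TensorProduct.assoc k Q A A).toLinearMap ∘ₗ g.rTensor A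

@[simp]
theorem extendLeft_tmul (g : P →ₗ[k] A ⊗[k] Q) (a : A) (p : P) :
    extendLeft g (a ⊗ₜ p) = (LinearMap.mulLeft k a).rTensor Q (g p) := by
  simp only [extendLeft, LinearMap.comp_apply, LinearMap.lTensor_tmul]
  induction g p using TensorProduct.induction_on with
  | zero => simp
  | tmul x y => simp
  | add x y hx hy => simp only [TensorProduct.tmul_add, map_add, hx, hy]

@[simp]
theorem extendRight_tmul (g : P →ₗ[k] Q ⊗[k] A) (p : P) (a : A) :
    extendRight g (p ⊗ₜ a) = (LinearMap.mulRight k a).lTensor Q (g p) := by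
  simp only [extendRight, LinearMap.comp_apply, LinearMap.rTensor_tmul]
  induction g p using TensorProduct.induction_on with
  | zero => simp
  | tmul x y => simp
  | add x y hx hy => simp only [TensorProduct.add_tmul, map_add, hx, hy]

theorem extendLeft_add (f g : P →ₗ[k] A ⊗[k] Q) :
    extendLeft (f + g) = extendLeft f + extendLeft g := by
  simp [extendLeft, LinearMap.lTensor_add, LinearMap.comp_add]

theorem extendLeft_smul (r : k) (g : P →ₗ[k] A ⊗[k] Q) :
    extendLeft (r • g) = r • extendLeft g := by
  simp [extendLeft, LinearMap.lTensor_smul, LinearMap.comp_smul]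

theorem extendRight_add (f g : P →ₗ[k] Q ⊗[k] A) :
    extendRight (f + g) = extendRight f + extendRight g := by
  simp [extendRight, LinearMap.rTensor_add, LinearMap.comp_add]

theorem extendRight_smul (r : k) (g : P →ₗ[k] Q ⊗[k] A) :
    extendRight (r • g) = r • extendRight g := by
  simp [extendRight, LinearMap.rTensor_smul, LinearMap.comp_smul]

/-- A linear map `P ⊗ A → A ⊗ P`, curried, that is compatible with the multiplication of `A`. -/
structure IsRightCrossing (ρ : A →ₗ[k] P →ₗ[k] A ⊗[k] P) : Prop where
  one : ∀ p, ρ 1 p = 1 ⊗ₜ p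
  mul : ∀ a b p, ρ (a * b) p = extendLeft (ρ b) (ρ a p)

/-- A linear map `A ⊗ P → P ⊗ A`, curried, that is compatible with the multiplication of `A`. -/
structure IsLeftCrossing (ρ : A →ₗ[k] P →ₗ[k] P ⊗[k] A) : Prop where
  one : ∀ p, ρ 1 p = p ⊗ₜ 1
  mul : ∀ a b p, ρ (a * b) p = extendRight (ρ a) (ρ b p)

/-- The elements of `A` past which `f` can be slid contain `1` and are closed under products,
because crossing a product means crossing its factors in succession. This is the main device for
reducing identities to generators. -/
theorem IsRightCrossing.natural {ι : V →ₗ[k] A} (hι : Generates ι)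
    {ρ : A →ₗ[k] P →ₗ[k] A ⊗[k] P} {ρ' : A →ₗ[k] Q →ₗ[k] A ⊗[k] Q}
    (hρ : IsRightCrossing ρ) (hρ' : IsRightCrossing ρ') (f : P →ₗ[k] Q)
    (h : ∀ v p, ρ' (ι v) (f p) = f.lTensor A (ρ (ι v) p)) (a : A) (p : P) :
    ρ' a (f p) = f.lTensor A (ρ a p) := by
  suffices H : (LinearMap.lcomp k _ f) ∘ₗ ρ' = (LinearMap.llcomp k P _ _ (f.lTensor A)) ∘ₗ ρ from
    LinearMap.congr_fun (LinearMap.congr_fun H a) p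
  refine hι.linearMap_ext ?_ (fun v => LinearMap.ext fun p => ?_) fun a b ha hb => ?_
  · ext p
    simp [hρ.one, hρ'.one]
  · simpa using h v p
  · replace ha : ∀ p, ρ' a (f p) = f.lTensor A (ρ a p) := LinearMap.congr_fun ha
    replace hb : ∀ p, ρ' b (f p) = f.lTensor A (ρ b p) := LinearMap.congr_fun hb
    refine LinearMap.ext fun p => ?_
    change ρ' (a * b) (f p) = f.lTensor A (ρ (a * b) p)
    rw [hρ.mul, hρ'.mul, ha]
    induction ρ a p using TensorProduct.induction_on with
    | zero => simp
    | tmul c q =>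
      simp only [LinearMap.lTensor_tmul, extendLeft_tmul, hb]
      rw [rTensor_lTensor_apply]
    | add x y hx hy => simp only [map_add, hx, hy]

theorem IsLeftCrossing.natural {ι : V →ₗ[k] A} (hι : Generates ι)
    {ρ : A →ₗ[k] P →ₗ[k] P ⊗[k] A} {ρ' : A →ₗ[k] Q →ₗ[k] Q ⊗[k] A}
    (hρ : IsLeftCrossing ρ) (hρ' : IsLeftCrossing ρ') (f : P →ₗ[k] Q)
    (h : ∀ v p, ρ' (ι v) (f p) = f.rTensor A (ρ (ι v) p)) (a : A) (p : P) :
    ρ' a (f p) = f.rTensor A (ρ a p) := by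
  suffices H : (LinearMap.lcomp k _ f) ∘ₗ ρ' = (LinearMap.llcomp k P _ _ (f.rTensor A)) ∘ₗ ρ from
    LinearMap.congr_fun (LinearMap.congr_fun H a) p
  refine hι.linearMap_ext ?_ (fun v => LinearMap.ext fun p => ?_) fun a b ha hb => ?_
  · ext p
    simp [hρ.one, hρ'.one]
  · simpa using h v p
  · replace ha : ∀ p, ρ' a (f p) = f.rTensor A (ρ a p) := LinearMap.congr_fun ha
    replace hb : ∀ p, ρ' b (f p) = f.rTensor A (ρ b p) := LinearMap.congr_fun hb
    refine LinearMap.ext fun p => ?_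
    change ρ' (a * b) (f p) = f.rTensor A (ρ (a * b) p)
    rw [hρ.mul, hρ'.mul, hb]
    induction ρ b p using TensorProduct.induction_on with
    | zero => simp
    | tmul q c =>
      simp only [LinearMap.rTensor_tmul, extendRight_tmul, ha]
      rw [rTensor_lTensor_apply]
    | add x y hx hy => simp only [map_add, hx, hy]

/-- Moving `p ⊗ q` past `ab` uses four elementary crossings. Those of `q` with `b` and of `p` with
`a` act on disjoint factors and can be exchanged, which turns one order of evaluation into the
other. -/
theorem IsRightCrossing.tensor {ρ : A →ₗ[k] P →ₗ[k] A ⊗[k] P} {ρ' : A →ₗ[k] Q →ₗ[k] A ⊗[k] Q}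
    (hρ : IsRightCrossing ρ) (hρ' : IsRightCrossing ρ') :
    IsRightCrossing (crossTensorRight ρ ρ') where
  one t := by
    induction t using TensorProduct.induction_on with
    | zero => simp
    | tmul p q => simp [hρ.one, hρ'.one]
    | add x y hx hy => simp only [map_add, TensorProduct.tmul_add, hx, hy]
  mul a b t := by
    induction t using TensorProduct.induction_on with
    | zero => simp
    | add x y hx hy => simp only [map_add, hx, hy]
    | tmul p q =>
      simp only [crossTensorRight_tmul, hρ'.mul]
      induction ρ' a q using TensorProduct.induction_on with
      | zero => simp
      | add x y hx hy => simp only [map_add, TensorProduct.tmul_add, hx, hy]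
      | tmul c q =>
        simp only [extendLeft_tmul, slideRight_tmul]
        -- The middle term is linear separately in the two independent crossings `ρ c p` and `ρ' b
        -- q`; each side is matched to it by expanding one of them at a time.
        trans extendLeft (slideRight ρ ∘ₗ (TensorProduct.mk k P (A ⊗[k] Q)).flip (ρ' b q)) (ρ c p)
        · induction ρ' b q using TensorProduct.induction_on with
          | zero => simp [extendLeft]
          | add x y hx hy =>
            simp only [map_add, TensorProduct.tmul_add, hx, hy, LinearMap.comp_add, extendLeft_add,
              LinearMap.add_apply]
          | tmul b q =>
            simp only [LinearMap.rTensor_tmul, LinearMap.mulLeft_apply, slideRight_tmul, hρ.mul]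
            induction ρ c p using TensorProduct.induction_on with
            | zero => simp
            | add x y hx hy => simp only [map_add, TensorProduct.add_tmul, hx, hy]
            | tmul c p =>
              simp only [extendLeft_tmul, LinearMap.comp_apply, LinearMap.flip_apply,
                TensorProduct.mk_apply, slideRight_tmul]
              induction ρ b p using TensorProduct.induction_on with
              | zero => simp
              | add x y hx hy => simp only [map_add, TensorProduct.add_tmul, hx, hy]
              | tmul b p => simp
        · induction ρ c p using TensorProduct.induction_on with
          | zero => simp
          | add x y hx hy => simp only [map_add, TensorProduct.add_tmul, hx, hy]
          | tmul c p => simp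

theorem IsLeftCrossing.tensor {ρ : A →ₗ[k] P →ₗ[k] P ⊗[k] A} {ρ' : A →ₗ[k] Q →ₗ[k] Q ⊗[k] A}
    (hρ : IsLeftCrossing ρ) (hρ' : IsLeftCrossing ρ') :
    IsLeftCrossing (crossTensorLeft ρ ρ') where
  one t := by
    induction t using TensorProduct.induction_on with
    | zero => simp
    | tmul p q => simp [hρ.one, hρ'.one]
    | add x y hx hy => simp only [map_add, TensorProduct.add_tmul, hx, hy]
  mul a b t := by
    induction t using TensorProduct.induction_on with
    | zero => simp
    | add x y hx hy => simp only [map_add, hx, hy]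
    | tmul q p =>
      simp only [crossTensorLeft_tmul, hρ'.mul]
      induction ρ' b q using TensorProduct.induction_on with
      | zero => simp
      | add x y hx hy => simp only [map_add, TensorProduct.add_tmul, hx, hy]
      | tmul q c =>
        simp only [extendRight_tmul, slideLeft_tmul]
        trans extendRight (slideLeft ρ ∘ₗ TensorProduct.mk k (Q ⊗[k] A) P (ρ' a q)) (ρ c p)
        · induction ρ' a q using TensorProduct.induction_on with
          | zero => simp [extendRight]
          | add x y hx hy =>
            simp only [map_add, TensorProduct.add_tmul, hx, hy, LinearMap.comp_add, extendRight_add,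
              LinearMap.add_apply]
          | tmul q a =>
            simp only [LinearMap.lTensor_tmul, LinearMap.mulRight_apply, slideLeft_tmul, hρ.mul]
            induction ρ c p using TensorProduct.induction_on with
            | zero => simp
            | add x y hx hy => simp only [map_add, TensorProduct.tmul_add, hx, hy]
            | tmul p c =>
              simp only [extendRight_tmul, LinearMap.comp_apply, TensorProduct.mk_apply,
                slideLeft_tmul]
              induction ρ a p using TensorProduct.induction_on with
              | zero => simp
              | add x y hx hy => simp only [map_add, TensorProduct.tmul_add, hx, hy]
              | tmul b p => simp
        · induction ρ c p using TensorProduct.induction_on with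
          | zero => simp
          | add x y hx hy => simp only [map_add, TensorProduct.tmul_add, hx, hy]
          | tmul c p => simp

end HalfBraidings

/-! ### Multiplicative braidings and reduction of the braid relation to generators. -/

section BraidRelation

variable {k : Type*} [CommSemiring k] {A : Type*} [NonAssocSemiring A] [Module k A]
  {V : Type*} [AddCommMonoid V] [Module k V]

@[simp]
theorem braid1_tmul (τ : V ⊗[k] V →ₗ[k] V ⊗[k] V) (t : V ⊗[k] V) (c : V) :
    braid1 τ (t ⊗ₜ c) = τ t ⊗ₜ c := rfl

@[simp]
theorem braid2_tmul (τ : V ⊗[k] V →ₗ[k] V ⊗[k] V) (a b c : V) :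
    braid2 τ ((a ⊗ₜ b) ⊗ₜ c) = (TensorProduct.assoc k V V V).symm (a ⊗ₜ τ (b ⊗ₜ c)) := by
  simp [braid2]

theorem slideRight_tmul_eq (σ : A ⊗[k] A →ₗ[k] A ⊗[k] A) (a : A) (t : A ⊗[k] A) :
    slideRight (TensorProduct.curry σ).flip (a ⊗ₜ t) = TensorProduct.assoc k A A A
      (braid1 σ ((TensorProduct.assoc k A A A).symm (a ⊗ₜ t))) := by
  induction t using TensorProduct.induction_on with
  | zero => simp
  | add x y hx hy => simp only [map_add, TensorProduct.tmul_add, hx, hy]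
  | tmul c p => simp

theorem slideLeft_tmul_eq (σ : A ⊗[k] A →ₗ[k] A ⊗[k] A) (a : A) (t : A ⊗[k] A) :
    slideLeft (TensorProduct.curry σ) (t ⊗ₜ a) = braid2 σ (t ⊗ₜ a) := by
  induction t using TensorProduct.induction_on with
  | zero => simp
  | add x y hx hy => simp only [map_add, TensorProduct.add_tmul, hx, hy]
  | tmul c p => simp

/-- This identifies one half of a side of the braid relation with the crossing of `A ⊗ A`, so that
the relation becomes naturality of that crossing along `σ`. -/
theorem crossTensorRight_curry (σ : A ⊗[k] A →ₗ[k] A ⊗[k] A) (a : A) (t : A ⊗[k] A) :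
    crossTensorRight (TensorProduct.curry σ).flip (TensorProduct.curry σ).flip a t =
      TensorProduct.assoc k A A A (braid1 σ (braid2 σ (t ⊗ₜ a))) := by
  induction t using TensorProduct.induction_on with
  | zero => simp
  | add x y hx hy => simp only [map_add, TensorProduct.add_tmul, hx, hy]
  | tmul c p => simp [slideRight_tmul_eq]

theorem crossTensorLeft_curry (σ : A ⊗[k] A →ₗ[k] A ⊗[k] A) (a : A) (t : A ⊗[k] A) :
    crossTensorLeft (TensorProduct.curry σ) (TensorProduct.curry σ) a t =
      braid2 σ (braid1 σ ((TensorProduct.assoc k A A A).symm (a ⊗ₜ t))) := by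
  induction t using TensorProduct.induction_on with
  | zero => simp
  | add x y hx hy => simp only [map_add, TensorProduct.tmul_add, hx, hy]
  | tmul c p => simp [slideLeft_tmul_eq]

variable [IsScalarTower k A A] [SMulCommClass k A A]

/-- `σ` is compatible with the unit and the multiplication of `A` in both arguments. -/
structure IsMulBraiding (σ : A ⊗[k] A →ₗ[k] A ⊗[k] A) : Prop where
  left : IsLeftCrossing (TensorProduct.curry σ)
  right : IsRightCrossing (TensorProduct.curry σ).flip

theorem mul_lTensor_braid (σ : A ⊗[k] A →ₗ[k] A ⊗[k] A) (a : A) (t : A ⊗[k] A) :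
    (LinearMap.mul' k A).lTensor A (TensorProduct.assoc k A A A (braid1 σ
      ((TensorProduct.assoc k A A A).symm (a ⊗ₜ t)))) =
      extendRight (TensorProduct.curry σ a) t := by
  induction t using TensorProduct.induction_on with
  | zero => simp
  | add x y hx hy => simp only [map_add, TensorProduct.tmul_add, hx, hy]
  | tmul c b =>
    simp only [TensorProduct.assoc_symm_tmul, braid1_tmul, extendRight_tmul,
      TensorProduct.curry_apply]
    induction σ (a ⊗ₜ c) using TensorProduct.induction_on with
    | zero => simp
    | add x y hx hy => simp only [map_add, TensorProduct.add_tmul, hx, hy]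
    | tmul c p => simp

theorem mul_rTensor_braid (σ : A ⊗[k] A →ₗ[k] A ⊗[k] A) (a : A) (t : A ⊗[k] A) :
    (LinearMap.mul' k A).rTensor A (braid2 σ (t ⊗ₜ a)) =
      extendLeft ((TensorProduct.curry σ).flip a) t := by
  induction t using TensorProduct.induction_on with
  | zero => simp
  | add x y hx hy => simp only [map_add, TensorProduct.add_tmul, hx, hy]
  | tmul c b =>
    simp only [braid2_tmul, extendLeft_tmul, LinearMap.flip_apply, TensorProduct.curry_apply]
    induction σ (b ⊗ₜ a) using TensorProduct.induction_on with
    | zero => simp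
    | add x y hx hy => simp only [map_add, TensorProduct.tmul_add, hx, hy]
    | tmul c p => simp

/-- Currying turns the unit and multiplication axioms into the two crossing conditions, separating
them from the braid relation. -/
theorem isBraidedAlgebra_iff (σ : A ⊗[k] A →ₗ[k] A ⊗[k] A) :
    IsBraidedAlgebra k σ ↔ IsBraiding σ ∧ IsMulBraiding σ := by
  refine ⟨fun h => ⟨h.braid, ⟨h.one_tmul, fun a b c => ?_⟩, ⟨h.tmul_one, fun a b c => ?_⟩⟩,
    fun h => ⟨h.1, h.2.left.one, h.2.right.one, ?_, ?_⟩⟩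
  · have := LinearMap.congr_fun h.mul_left ((a ⊗ₜ b) ⊗ₜ c)
    simpa [mul_lTensor_braid] using this
  · have := LinearMap.congr_fun h.mul_right ((c ⊗ₜ a) ⊗ₜ b)
    simpa [mul_rTensor_braid] using this
  · refine TensorProduct.ext_threefold fun a b c => ?_
    simpa [mul_lTensor_braid] using h.2.left.mul a b c
  · refine TensorProduct.ext_threefold fun a b c => ?_
    simpa [mul_rTensor_braid] using h.2.right.mul b c a

theorem IsMulBraiding.one_tmul {σ : A ⊗[k] A →ₗ[k] A ⊗[k] A} (hσ : IsMulBraiding σ) (a : A) :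
    σ (1 ⊗ₜ a) = a ⊗ₜ 1 := hσ.left.one a

theorem IsMulBraiding.tmul_one {σ : A ⊗[k] A →ₗ[k] A ⊗[k] A} (hσ : IsMulBraiding σ) (a : A) :
    σ (a ⊗ₜ 1) = 1 ⊗ₜ a := hσ.right.one a

theorem IsMulBraiding.mul_tmul {σ : A ⊗[k] A →ₗ[k] A ⊗[k] A} (hσ : IsMulBraiding σ) (a b c : A) :
    σ ((a * b) ⊗ₜ c) = extendRight (TensorProduct.curry σ a) (σ (b ⊗ₜ c)) := hσ.left.mul a b c

theorem IsMulBraiding.tmul_mul {σ : A ⊗[k] A →ₗ[k] A ⊗[k] A} (hσ : IsMulBraiding σ) (a b c : A) :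
    σ (a ⊗ₜ (b * c)) = extendLeft ((TensorProduct.curry σ).flip c) (σ (a ⊗ₜ b)) :=
  hσ.right.mul b c a

/-- The braid relation in the first argument follows from the generators. -/
theorem IsMulBraiding.braid_left {ι : V →ₗ[k] A} (hι : Generates ι)
    {σ : A ⊗[k] A →ₗ[k] A ⊗[k] A} (hσ : IsMulBraiding σ) (b c : A)
    (h : ∀ v b c, braid1 σ (braid2 σ (braid1 σ ((ι v ⊗ₜ b) ⊗ₜ c))) =
      braid2 σ (braid1 σ (braid2 σ ((ι v ⊗ₜ b) ⊗ₜ c)))) (a : A) :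
    braid1 σ (braid2 σ (braid1 σ ((a ⊗ₜ b) ⊗ₜ c))) =
      braid2 σ (braid1 σ (braid2 σ ((a ⊗ₜ b) ⊗ₜ c))) := by
  have hT := hσ.left.tensor hσ.left
  -- The braid relation says that `σ` on the last two factors commutes with moving `a` past both of
  -- them, that is, naturality along `f = σ`.
  have := hT.natural hι hT σ (fun v t => ?_) a (b ⊗ₜ c)
  · rw [crossTensorLeft_curry, crossTensorLeft_curry] at this
    simpa [braid1] using this.symm
  · rw [crossTensorLeft_curry, crossTensorLeft_curry]
    induction t using TensorProduct.induction_on with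
    | zero => simp
    | add x y hx hy => simp only [map_add, TensorProduct.tmul_add, hx, hy]
    | tmul x y => simpa [braid1] using (h v x y).symm

/-- The braid relation in the last argument follows from the generators. -/
theorem IsMulBraiding.braid_right {ι : V →ₗ[k] A} (hι : Generates ι)
    {σ : A ⊗[k] A →ₗ[k] A ⊗[k] A} (hσ : IsMulBraiding σ) {ρ : A →ₗ[k] V →ₗ[k] A ⊗[k] V}
    (hρ : IsRightCrossing ρ) (hρσ : ∀ a v, σ (ι v ⊗ₜ a) = ι.lTensor A (ρ a v))
    (h : ∀ v b w, braid1 σ (braid2 σ (braid1 σ ((ι v ⊗ₜ b) ⊗ₜ ι w))) =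
      braid2 σ (braid1 σ (braid2 σ ((ι v ⊗ₜ b) ⊗ₜ ι w)))) (v : V) (b c : A) :
    braid1 σ (braid2 σ (braid1 σ ((ι v ⊗ₜ b) ⊗ₜ c))) =
      braid2 σ (braid1 σ (braid2 σ ((ι v ⊗ₜ b) ⊗ₜ c))) := by
  have hT := hσ.right.tensor hσ.right
  have cross : ∀ c (t : V ⊗[k] A), (ι.rTensor A).lTensor A
      (crossTensorRight ρ (TensorProduct.curry σ).flip c t) =
      TensorProduct.assoc k A A A (braid1 σ (braid2 σ (ι.rTensor A t ⊗ₜ c))) := by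
    intro c t
    rw [← crossTensorRight_curry]
    induction t using TensorProduct.induction_on with
    | zero => simp
    | add x y hx hy => simp only [map_add, hx, hy]
    | tmul v b =>
      simp only [crossTensorRight_tmul, LinearMap.rTensor_tmul, LinearMap.flip_apply,
        TensorProduct.curry_apply]
      induction σ (b ⊗ₜ c) using TensorProduct.induction_on with
      | zero => simp
      | add x y hx hy => simp only [map_add, TensorProduct.tmul_add, hx, hy]
      | tmul c b =>
        simp only [slideRight_tmul, LinearMap.flip_apply, TensorProduct.curry_apply, hρσ]
        induction ρ c v using TensorProduct.induction_on with
        | zero => simp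
        | add x y hx hy => simp only [map_add, TensorProduct.add_tmul, hx, hy]
        | tmul c v => simp
  -- The source is `V ⊗ A` instead of `A ⊗ A` because `h` is available only for a generator in the
  -- first slot; `ρ` ensures that crossing keeps that factor in `V`.
  have := (hρ.tensor hσ.right).natural hι hT (σ ∘ₗ ι.rTensor A) (fun w t => ?_) c (v ⊗ₜ b)
  · rw [LinearMap.lTensor_comp, LinearMap.comp_apply, LinearMap.comp_apply, cross,
      crossTensorRight_curry] at this
    exact (TensorProduct.assoc k A A A).injective (this.trans (by simp [braid2]))
  · rw [LinearMap.lTensor_comp, LinearMap.comp_apply, LinearMap.comp_apply, cross,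
      crossTensorRight_curry]
    induction t using TensorProduct.induction_on with
    | zero => simp
    | add x y hx hy => simp only [map_add, TensorProduct.add_tmul, hx, hy]
    | tmul v b =>
      refine (congrArg (TensorProduct.assoc k A A A) (h v b w)).trans ?_
      simp [braid2]

/-- The map `(c ⊗ p) ⊗ (w ⊗ d) ↦ w'' ⊗ c' d' ⊗ p''`, where `w` passes to the left of `p` and `c`,
and `d` passes to the left of `p`. -/
noncomputable def crossMul (σ : A ⊗[k] A →ₗ[k] A ⊗[k] A) :
    (A ⊗[k] A) ⊗[k] (A ⊗[k] A) →ₗ[k] (A ⊗[k] A) ⊗[k] A :=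
  ((LinearMap.mul' k A).lTensor A).rTensor A ∘ₗ
    (TensorProduct.tensorTensorTensorAssoc k A A A A).toLinearMap ∘ₗ
    TensorProduct.map σ σ ∘ₗ
    (TensorProduct.tensorTensorTensorAssoc k A A A A).symm.toLinearMap ∘ₗ
    (σ.lTensor A).rTensor A ∘ₗ
    (TensorProduct.tensorTensorTensorAssoc k A A A A).toLinearMap

/-- After `p` has passed `w`, the crossings of `c` with `w` and of `p` with `d` touch disjoint
factors. Doing the second one first groups both crossings of `p`; `crossMul_tmul_right` makes the
other choice and groups both crossings of `w`. -/
theorem crossMul_tmul_left (σ : A ⊗[k] A →ₗ[k] A ⊗[k] A) (c p : A) (t : A ⊗[k] A) :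
    crossMul σ ((c ⊗ₜ p) ⊗ₜ t) = (extendRight (TensorProduct.curry σ c)).rTensor A
      (braid2 σ (braid1 σ ((TensorProduct.assoc k A A A).symm (p ⊗ₜ t)))) := by
  induction t using TensorProduct.induction_on with
  | zero => simp
  | add x y hx hy => simp only [map_add, TensorProduct.tmul_add, hx, hy]
  | tmul w d =>
    simp only [crossMul, LinearMap.comp_apply, LinearEquiv.coe_coe,
      TensorProduct.tensorTensorTensorAssoc_tmul, LinearMap.rTensor_tmul, LinearMap.lTensor_tmul,
      TensorProduct.assoc_symm_tmul, braid1_tmul]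
    induction σ (p ⊗ₜ w) using TensorProduct.induction_on with
    | zero => simp
    | add x y hx hy => simp only [map_add, TensorProduct.add_tmul, TensorProduct.tmul_add, hx, hy]
    | tmul w p =>
      simp only [TensorProduct.tensorTensorTensorAssoc_symm_tmul, TensorProduct.map_tmul,
        braid2_tmul]
      induction σ (p ⊗ₜ d) using TensorProduct.induction_on with
      | zero => simp
      | add x y hx hy => simp only [map_add, TensorProduct.tmul_add, hx, hy]
      | tmul d p =>
        simp only [TensorProduct.assoc_symm_tmul, LinearMap.rTensor_tmul, extendRight_tmul,
          TensorProduct.curry_apply]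
        induction σ (c ⊗ₜ w) using TensorProduct.induction_on with
        | zero => simp
        | add x y hx hy => simp only [map_add, TensorProduct.add_tmul, hx, hy]
        | tmul w c => simp

theorem crossMul_tmul_right (σ : A ⊗[k] A →ₗ[k] A ⊗[k] A) (w d : A) (t : A ⊗[k] A) :
    crossMul σ (t ⊗ₜ (w ⊗ₜ d)) = (TensorProduct.assoc k A A A).symm
      ((extendLeft ((TensorProduct.curry σ).flip d)).lTensor A
        (TensorProduct.assoc k A A A (braid1 σ (braid2 σ (t ⊗ₜ w))))) := by
  induction t using TensorProduct.induction_on with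
  | zero => simp
  | add x y hx hy => simp only [map_add, TensorProduct.add_tmul, hx, hy]
  | tmul c p =>
    simp only [crossMul, LinearMap.comp_apply, LinearEquiv.coe_coe,
      TensorProduct.tensorTensorTensorAssoc_tmul, LinearMap.rTensor_tmul, LinearMap.lTensor_tmul,
      braid2_tmul]
    induction σ (p ⊗ₜ w) using TensorProduct.induction_on with
    | zero => simp
    | add x y hx hy => simp only [map_add, TensorProduct.add_tmul, TensorProduct.tmul_add, hx, hy]
    | tmul w p =>
      simp only [TensorProduct.tensorTensorTensorAssoc_symm_tmul, TensorProduct.map_tmul,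
        TensorProduct.assoc_symm_tmul, braid1_tmul]
      induction σ (c ⊗ₜ w) using TensorProduct.induction_on with
      | zero => simp
      | add x y hx hy => simp only [map_add, TensorProduct.add_tmul, hx, hy]
      | tmul w c =>
        simp only [TensorProduct.assoc_tmul, LinearMap.lTensor_tmul, extendLeft_tmul,
          TensorProduct.curry_apply, LinearMap.flip_apply]
        induction σ (p ⊗ₜ d) using TensorProduct.induction_on with
        | zero => simp
        | add x y hx hy => simp only [map_add, TensorProduct.tmul_add, hx, hy]
        | tmul d p => simp

theorem IsMulBraiding.braid_extendLeft {σ : A ⊗[k] A →ₗ[k] A ⊗[k] A} (hσ : IsMulBraiding σ)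
    (c w : A) (s : A ⊗[k] A) :
    braid1 σ (braid2 σ ((LinearMap.mulLeft k c).rTensor A s ⊗ₜ w)) =
      (extendRight (TensorProduct.curry σ c)).rTensor A (braid1 σ (braid2 σ (s ⊗ₜ w))) := by
  induction s using TensorProduct.induction_on with
  | zero => simp
  | add x y hx hy => simp only [map_add, TensorProduct.add_tmul, hx, hy]
  | tmul b p =>
    simp only [LinearMap.rTensor_tmul, LinearMap.mulLeft_apply, braid2_tmul]
    induction σ (p ⊗ₜ w) using TensorProduct.induction_on with
    | zero => simp
    | add x y hx hy => simp only [map_add, TensorProduct.tmul_add, hx, hy]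
    | tmul w p => simp [hσ.mul_tmul]

theorem IsMulBraiding.braid_extendRight {σ : A ⊗[k] A →ₗ[k] A ⊗[k] A} (hσ : IsMulBraiding σ)
    (d p : A) (t : A ⊗[k] A) :
    braid2 σ (braid1 σ ((TensorProduct.assoc k A A A).symm
      (p ⊗ₜ (LinearMap.mulRight k d).lTensor A t))) =
      (TensorProduct.assoc k A A A).symm ((extendLeft ((TensorProduct.curry σ).flip d)).lTensor A
        (TensorProduct.assoc k A A A
          (braid2 σ (braid1 σ ((TensorProduct.assoc k A A A).symm (p ⊗ₜ t)))))) := by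
  induction t using TensorProduct.induction_on with
  | zero => simp
  | add x y hx hy => simp only [map_add, TensorProduct.tmul_add, hx, hy]
  | tmul w b =>
    simp only [LinearMap.lTensor_tmul, LinearMap.mulRight_apply, TensorProduct.assoc_symm_tmul,
      braid1_tmul]
    induction σ (p ⊗ₜ w) using TensorProduct.induction_on with
    | zero => simp
    | add x y hx hy => simp only [map_add, TensorProduct.add_tmul, hx, hy]
    | tmul w p => simp [hσ.tmul_mul]

/-- The braid relation in the middle argument follows from the generators. -/
theorem IsMulBraiding.braid_middle {ι : V →ₗ[k] A} (hι : Generates ι)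
    {σ : A ⊗[k] A →ₗ[k] A ⊗[k] A} (hσ : IsMulBraiding σ) {ρ : A →ₗ[k] V →ₗ[k] A ⊗[k] V}
    (hρσ : ∀ a v, σ (ι v ⊗ₜ a) = ι.lTensor A (ρ a v)) {ρ' : A →ₗ[k] V →ₗ[k] V ⊗[k] A}
    (hρσ' : ∀ a v, σ (a ⊗ₜ ι v) = ι.rTensor A (ρ' a v))
    (h : ∀ u v w, braid1 σ (braid2 σ (braid1 σ ((ι u ⊗ₜ ι v) ⊗ₜ ι w))) =
      braid2 σ (braid1 σ (braid2 σ ((ι u ⊗ₜ ι v) ⊗ₜ ι w)))) (v : V) (b : A) (w : V) :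
    braid1 σ (braid2 σ (braid1 σ ((ι v ⊗ₜ b) ⊗ₜ ι w))) =
      braid2 σ (braid1 σ (braid2 σ ((ι v ⊗ₜ b) ⊗ₜ ι w))) := by
  let J : (V ⊗[k] A) ⊗[k] V →ₗ[k] (A ⊗[k] A) ⊗[k] A := TensorProduct.map (ι.rTensor A) ι
  -- The middle slot becomes the induction variable while both outer generators stay universally
  -- quantified: in the product step the hypotheses are applied to new outer generators produced by
  -- crossings.
  suffices H : (TensorProduct.curry (TensorProduct.curry
      ((braid1 σ ∘ₗ braid2 σ ∘ₗ braid1 σ) ∘ₗ J))).flip = (TensorProduct.curry (TensorProduct.curry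
      ((braid2 σ ∘ₗ braid1 σ ∘ₗ braid2 σ) ∘ₗ J))).flip from
    LinearMap.congr_fun (LinearMap.congr_fun (LinearMap.congr_fun H b) v) w
  refine hι.linearMap_ext (LinearMap.ext₂ fun p w => ?_) (fun v => LinearMap.ext₂ fun p w => ?_)
    fun a b ha hb => LinearMap.ext₂ fun p w => ?_
  · change braid1 σ (braid2 σ (braid1 σ ((ι p ⊗ₜ 1) ⊗ₜ ι w))) =
      braid2 σ (braid1 σ (braid2 σ ((ι p ⊗ₜ 1) ⊗ₜ ι w)))
    simp only [braid1_tmul, braid2_tmul, hσ.tmul_one, hσ.one_tmul, TensorProduct.assoc_symm_tmul]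
    induction σ (ι p ⊗ₜ ι w) using TensorProduct.induction_on with
    | zero => simp
    | add x y hx hy => simp only [map_add, TensorProduct.add_tmul, TensorProduct.tmul_add, hx, hy]
    | tmul w p => simp [hσ.tmul_one, hσ.one_tmul]
  · exact h p v w
  · replace ha : ∀ p w, braid1 σ (braid2 σ (braid1 σ ((ι p ⊗ₜ a) ⊗ₜ ι w))) =
      braid2 σ (braid1 σ (braid2 σ ((ι p ⊗ₜ a) ⊗ₜ ι w))) := fun p w =>
      LinearMap.congr_fun (LinearMap.congr_fun ha p) w
    replace hb : ∀ p w, braid1 σ (braid2 σ (braid1 σ ((ι p ⊗ₜ b) ⊗ₜ ι w))) =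
      braid2 σ (braid1 σ (braid2 σ ((ι p ⊗ₜ b) ⊗ₜ ι w))) := fun p w =>
      LinearMap.congr_fun (LinearMap.congr_fun hb p) w
    change braid1 σ (braid2 σ (braid1 σ ((ι p ⊗ₜ (a * b)) ⊗ₜ ι w))) =
      braid2 σ (braid1 σ (braid2 σ ((ι p ⊗ₜ (a * b)) ⊗ₜ ι w)))
    simp only [braid1_tmul, braid2_tmul] at ha hb ⊢
    -- Both sides for the product `a * b` reduce to this expression: the left one by the relation
    -- for `b`, the right one by the relation for `a`.
    trans crossMul σ (σ (ι p ⊗ₜ a) ⊗ₜ σ (b ⊗ₜ ι w))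
    · rw [hσ.tmul_mul, hρσ]
      induction ρ a p using TensorProduct.induction_on with
      | zero => simp
      | add x y hx hy => simp only [map_add, TensorProduct.add_tmul, hx, hy]
      | tmul c p =>
        rw [LinearMap.lTensor_tmul, extendLeft_tmul, hσ.braid_extendLeft, crossMul_tmul_left, ← hb]
        simp
    · rw [hσ.mul_tmul, hρσ']
      induction ρ' b w using TensorProduct.induction_on with
      | zero => simp
      | add x y hx hy => simp only [map_add, TensorProduct.tmul_add, hx, hy]
      | tmul w d =>
        rw [LinearMap.rTensor_tmul, extendRight_tmul, hσ.braid_extendRight, crossMul_tmul_right, ha]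
        simp

/-- The order of the reductions matters: the first slot is reduced without restriction, the last one
with a generator in the first, and the middle one with generators on both sides. What remains is the
relation for `τ`. -/
theorem IsMulBraiding.isBraiding {ι : V →ₗ[k] A} (hι : Generates ι)
    {σ : A ⊗[k] A →ₗ[k] A ⊗[k] A} (hσ : IsMulBraiding σ) {ρ : A →ₗ[k] V →ₗ[k] A ⊗[k] V}
    (hρ : IsRightCrossing ρ) (hρσ : ∀ a v, σ (ι v ⊗ₜ a) = ι.lTensor A (ρ a v))
    {ρ' : A →ₗ[k] V →ₗ[k] V ⊗[k] A} (hρσ' : ∀ a v, σ (a ⊗ₜ ι v) = ι.rTensor A (ρ' a v))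
    {τ : V ⊗[k] V →ₗ[k] V ⊗[k] V} (hτ : IsBraiding τ)
    (h : σ ∘ₗ TensorProduct.map ι ι = TensorProduct.map ι ι ∘ₗ τ) : IsBraiding σ := by
  replace h : ∀ t, σ (TensorProduct.map ι ι t) = TensorProduct.map ι ι (τ t) :=
    LinearMap.congr_fun h
  have h1 : ∀ t, braid1 σ (TensorProduct.map (TensorProduct.map ι ι) ι t) =
      TensorProduct.map (TensorProduct.map ι ι) ι (braid1 τ t) := by
    intro t
    induction t using TensorProduct.induction_on with
    | zero => simp
    | add x y hx hy => simp only [map_add, hx, hy]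
    | tmul s c => simp [h]
  have h2 : ∀ t, braid2 σ (TensorProduct.map (TensorProduct.map ι ι) ι t) =
      TensorProduct.map (TensorProduct.map ι ι) ι (braid2 τ t) := by
    intro t
    refine LinearMap.congr_fun (f := braid2 σ ∘ₗ TensorProduct.map (TensorProduct.map ι ι) ι)
      (g := TensorProduct.map (TensorProduct.map ι ι) ι ∘ₗ braid2 τ)
      (TensorProduct.ext_threefold fun a b c => ?_) t
    have := h (b ⊗ₜ c)
    simp only [LinearMap.comp_apply, TensorProduct.map_tmul, braid2_tmul] at this ⊢
    rw [this]
    induction τ (b ⊗ₜ c) using TensorProduct.induction_on with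
    | zero => simp
    | add x y hx hy => simp only [map_add, TensorProduct.tmul_add, hx, hy]
    | tmul s c => simp
  refine TensorProduct.ext_threefold fun a b c => hσ.braid_left hι _ _
    (hσ.braid_right hι hρ hρσ (hσ.braid_middle hι hρσ hρσ' fun u v w => ?_)) _
  have := LinearMap.congr_fun hτ ((u ⊗ₜ v) ⊗ₜ w)
  have huvw : (ι u ⊗ₜ[k] ι v) ⊗ₜ[k] ι w =
    TensorProduct.map (TensorProduct.map ι ι) ι ((u ⊗ₜ v) ⊗ₜ w) := rfl
  simp only [huvw, h1, h2]
  exact congrArg _ this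

end BraidRelation

/-! ### Crossings as homomorphisms to a unital algebra of linear maps. -/

section Kleisli

variable {k : Type*} [CommSemiring k] {A : Type*} [NonAssocSemiring A] [Module k A]
  [IsScalarTower k A A] [SMulCommClass k A A]

/-- The multiplication on `Hom(P, A ⊗ P)` whose algebra homomorphisms from `A` are the right
crossings. -/
noncomputable def crossMulRight (A P : Type*) [NonAssocSemiring A] [Module k A]
    [IsScalarTower k A A] [SMulCommClass k A A] [AddCommMonoid P] [Module k P] :
    (P →ₗ[k] A ⊗[k] P) →ₗ[k] (P →ₗ[k] A ⊗[k] P) →ₗ[k] (P →ₗ[k] A ⊗[k] P) :=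
  LinearMap.mk₂ k (fun f g => extendLeft g ∘ₗ f) (fun _ _ _ => LinearMap.comp_add _ _ _)
    (fun _ _ _ => LinearMap.comp_smul _ _ _)
    (fun _ _ _ => by rw [extendLeft_add, LinearMap.add_comp])
    (fun _ _ _ => by rw [extendLeft_smul, LinearMap.smul_comp])

/-- The multiplication on `Hom(P, P ⊗ A)` whose algebra homomorphisms from `A` are the left
crossings. -/
noncomputable def crossMulLeft (A P : Type*) [NonAssocSemiring A] [Module k A]
    [IsScalarTower k A A] [SMulCommClass k A A] [AddCommMonoid P] [Module k P] :
    (P →ₗ[k] P ⊗[k] A) →ₗ[k] (P →ₗ[k] P ⊗[k] A) →ₗ[k] (P →ₗ[k] P ⊗[k] A) :=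
  LinearMap.mk₂ k (fun f g => extendRight f ∘ₗ g)
    (fun _ _ _ => by rw [extendRight_add, LinearMap.add_comp])
    (fun _ _ _ => by rw [extendRight_smul, LinearMap.smul_comp])
    (fun _ _ _ => LinearMap.comp_add _ _ _) (fun _ _ _ => LinearMap.comp_smul _ _ _)

variable {P : Type*} [AddCommMonoid P] [Module k P]

theorem crossMulRight_one_left (f : P →ₗ[k] A ⊗[k] P) :
    crossMulRight A P (TensorProduct.mk k A P 1) f = f := by
  ext p
  change extendLeft f (1 ⊗ₜ p) = f p
  rw [extendLeft_tmul, LinearMap.mulLeft_one, LinearMap.rTensor_id, LinearMap.id_apply]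

theorem crossMulRight_one_right (f : P →ₗ[k] A ⊗[k] P) :
    crossMulRight A P f (TensorProduct.mk k A P 1) = f := by
  ext p
  change extendLeft (TensorProduct.mk k A P 1) (f p) = f p
  induction f p using TensorProduct.induction_on with
  | zero => simp
  | add x y hx hy => simp only [map_add, hx, hy]
  | tmul a p => simp

theorem crossMulLeft_one_left (f : P →ₗ[k] P ⊗[k] A) :
    crossMulLeft A P ((TensorProduct.mk k P A).flip 1) f = f := by
  ext p
  change extendRight ((TensorProduct.mk k P A).flip 1) (f p) = f p
  induction f p using TensorProduct.induction_on with
  | zero => simp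
  | add x y hx hy => simp only [map_add, hx, hy]
  | tmul a p => simp

theorem crossMulLeft_one_right (f : P →ₗ[k] P ⊗[k] A) :
    crossMulLeft A P f ((TensorProduct.mk k P A).flip 1) = f := by
  ext p
  change extendRight f (p ⊗ₜ 1) = f p
  rw [extendRight_tmul, LinearMap.mulRight_one, LinearMap.lTensor_id, LinearMap.id_apply]

end Kleisli

/-! ### The universal property of the free nonassociative algebra. -/

section FreeAlgebra

variable {k : Type*} [Field k] {X : Type*} {M : Type*} [AddCommMonoid M] [Module k M]

/-- The values on the nonassociative words of the homomorphism determined by `f : X → M`. -/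
noncomputable def wordLift (μ : M →ₗ[k] M →ₗ[k] M) (e : M) (f : X → M) : WithOne (FreeMagma X) → M :=
  WithOne.recOneCoe e (FreeMagma.rec f fun _ _ m n => μ m n)

/-- The homomorphism from the free nonassociative algebra to the module `M` with the
multiplication `μ` and the unit `e` that is determined by `f : X → M`. -/
noncomputable def freeLift (μ : M →ₗ[k] M →ₗ[k] M) (e : M) (f : X → M) :
    FreeNonassocAlgebra k X →ₗ[k] M :=
  (MonoidAlgebra.basis (WithOne (FreeMagma X)) k).constr k (wordLift μ e f)

theorem freeLift_single (μ : M →ₗ[k] M →ₗ[k] M) (e : M) (f : X → M) (w : WithOne (FreeMagma X)) :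
    freeLift μ e f (MonoidAlgebra.single w 1) = wordLift μ e f w := by
  rw [← MonoidAlgebra.basis_apply, freeLift, Module.Basis.constr_basis]

theorem freeLift_one (μ : M →ₗ[k] M →ₗ[k] M) (e : M) (f : X → M) : freeLift μ e f 1 = e := by
  rw [MonoidAlgebra.one_def, freeLift_single]
  rfl

theorem freeLift_gen (μ : M →ₗ[k] M →ₗ[k] M) (e : M) (f : X → M) (x : X) :
    freeLift μ e f (gen k x) = f x := by
  rw [gen, freeLift_single]
  rfl

/-- The product of nonempty words is a free magma product, so no associativity of `μ` is required.
The two unit laws serve only the empty word. -/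
theorem freeLift_mul (μ : M →ₗ[k] M →ₗ[k] M) (e : M) (f : X → M) (hl : ∀ m, μ e m = m)
    (hr : ∀ m, μ m e = m) (a b : FreeNonassocAlgebra k X) :
    freeLift μ e f (a * b) = μ (freeLift μ e f a) (freeLift μ e f b) := by
  suffices H : (LinearMap.mul k (FreeNonassocAlgebra k X)).compr₂ (freeLift μ e f) =
      μ.compl₁₂ (freeLift μ e f) (freeLift μ e f) from
    LinearMap.congr_fun (LinearMap.congr_fun H a) b
  refine (MonoidAlgebra.basis (WithOne (FreeMagma X)) k).ext fun v =>
    (MonoidAlgebra.basis (WithOne (FreeMagma X)) k).ext fun w => ?_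
  simp only [MonoidAlgebra.basis_apply, LinearMap.compr₂_apply, LinearMap.mul_apply',
    LinearMap.compl₁₂_apply, MonoidAlgebra.single_mul_single, mul_one, freeLift_single]
  cases v using WithOne.recOneCoe with
  | one => rw [one_mul]; exact (hl _).symm
  | coe v =>
    cases w using WithOne.recOneCoe with
    | one => rw [mul_one]; exact (hr _).symm
    | coe w => rfl

variable {V : Type*} [AddCommGroup V] [Module k V] (b : Module.Basis X k V)

theorem incl_basis (x : X) : incl b (b x) = gen k x := by
  rw [incl, Module.Basis.constr_basis]

theorem freeLift_incl (μ : M →ₗ[k] M →ₗ[k] M) (e : M) (f : V →ₗ[k] M) (v : V) :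
    freeLift μ e (f ∘ b) (incl b v) = f v := by
  suffices H : freeLift μ e (f ∘ b) ∘ₗ incl b = f from LinearMap.congr_fun H v
  refine b.ext fun x => ?_
  simp [incl_basis, freeLift_gen]

theorem generates_incl : Generates (incl b) := by
  intro S one gen mul a
  have hw : ∀ w : WithOne (FreeMagma X), MonoidAlgebra.single w (1 : k) ∈ S := by
    intro w
    cases w using WithOne.recOneCoe with
    | one => simpa [MonoidAlgebra.one_def] using one
    | coe w =>
      induction w with
      | ih1 x => simpa [incl_basis, BraidedNA.gen] using gen (b x)
      | ih2 u v hu hv => simpa [MonoidAlgebra.single_mul_single] using mul _ hu _ hv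
  refine (Submodule.span_le (p := S)).2 ?_
    ((MonoidAlgebra.basis (WithOne (FreeMagma X)) k).mem_span a)
  rintro _ ⟨w, rfl⟩
  simpa [MonoidAlgebra.basis_apply] using hw w

/-- The product of `crossMulRight` is exactly the crossing law for products, so freeness allows
arbitrary values on generators. -/
theorem exists_rightCrossing {P : Type*} [AddCommMonoid P] [Module k P]
    (f : V →ₗ[k] P →ₗ[k] FreeNonassocAlgebra k X ⊗[k] P) :
    ∃ ρ : FreeNonassocAlgebra k X →ₗ[k] P →ₗ[k] FreeNonassocAlgebra k X ⊗[k] P,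
      IsRightCrossing ρ ∧ ∀ v, ρ (incl b v) = f v := by
  refine ⟨freeLift (crossMulRight _ P) (TensorProduct.mk k _ P 1) (f ∘ b), ⟨fun p => ?_,
    fun a c p => ?_⟩, freeLift_incl b _ _ _⟩
  · rw [freeLift_one, TensorProduct.mk_apply]
  · rw [freeLift_mul _ _ _ crossMulRight_one_left crossMulRight_one_right]
    rfl

theorem exists_leftCrossing {P : Type*} [AddCommMonoid P] [Module k P]
    (f : V →ₗ[k] P →ₗ[k] P ⊗[k] FreeNonassocAlgebra k X) :
    ∃ ρ : FreeNonassocAlgebra k X →ₗ[k] P →ₗ[k] P ⊗[k] FreeNonassocAlgebra k X,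
      IsLeftCrossing ρ ∧ ∀ v, ρ (incl b v) = f v := by
  refine ⟨freeLift (crossMulLeft _ P) ((TensorProduct.mk k P _).flip 1) (f ∘ b), ⟨fun p => ?_,
    fun a c p => ?_⟩, freeLift_incl b _ _ _⟩
  · rw [freeLift_one, LinearMap.flip_apply, TensorProduct.mk_apply]
  · rw [freeLift_mul _ _ _ crossMulLeft_one_left crossMulLeft_one_right]
    rfl

end FreeAlgebra

/-! ### Building a braiding from a crossing, and its uniqueness. -/

section Extension

variable {k : Type*} [CommSemiring k] {A : Type*} [NonAssocSemiring A] [Module k A]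
  [IsScalarTower k A A] [SMulCommClass k A A] {V : Type*} [AddCommMonoid V] [Module k V]
  {ι : V →ₗ[k] A} {τ : V ⊗[k] V →ₗ[k] V ⊗[k] V} {σ : A ⊗[k] A →ₗ[k] A ⊗[k] A}
  {ρ : A →ₗ[k] V →ₗ[k] A ⊗[k] V} {ρ' : A →ₗ[k] V →ₗ[k] V ⊗[k] A}

/-- The braiding of a generator with an arbitrary element is the right crossing of the space of
generators. -/
theorem IsMulBraiding.incl_tmul (hι : Generates ι) (hσ : IsMulBraiding σ)
    (h : ∀ v w, σ (ι v ⊗ₜ ι w) = TensorProduct.map ι ι (τ (v ⊗ₜ w))) (hρ : IsRightCrossing ρ)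
    (hρι : ∀ v w, ρ (ι w) v = ι.rTensor V (τ (v ⊗ₜ w))) (a : A) (v : V) :
    σ (ι v ⊗ₜ a) = ι.lTensor A (ρ a v) := by
  refine hρ.natural hι hσ.right ι (fun w v => ?_) a v
  rw [hρι]
  refine (h v w).trans ?_
  rw [← LinearMap.lTensor_comp_rTensor]
  rfl

/-- The braiding of an arbitrary element with a generator is the left crossing of the space of
generators. -/
theorem IsMulBraiding.tmul_incl (hι : Generates ι) (hσ : IsMulBraiding σ)
    (h : ∀ v w, σ (ι v ⊗ₜ ι w) = TensorProduct.map ι ι (τ (v ⊗ₜ w))) (hρ : IsLeftCrossing ρ')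
    (hρι : ∀ v w, ρ' (ι v) w = ι.lTensor V (τ (v ⊗ₜ w))) (a : A) (v : V) :
    σ (a ⊗ₜ ι v) = ι.rTensor A (ρ' a v) := by
  refine hρ.natural hι hσ.left ι (fun w v => ?_) a v
  rw [hρι]
  refine (h w v).trans ?_
  rw [← LinearMap.rTensor_comp_lTensor]
  rfl

/-- Both flipped maps are right crossings of `A`, so naturality along the identity map compares
them. -/
theorem IsMulBraiding.eq_of_tmul_incl (hι : Generates ι) (hσ : IsMulBraiding σ)
    {σ' : A ⊗[k] A →ₗ[k] A ⊗[k] A} (hσ' : IsMulBraiding σ')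
    (h : ∀ a v, σ (a ⊗ₜ ι v) = σ' (a ⊗ₜ ι v)) : σ = σ' := by
  refine TensorProduct.ext' fun a c => ?_
  simpa using (hσ'.right.natural hι hσ.right LinearMap.id (fun v a => by simpa using h a v) c a)

/-- Compatibility in the second argument is built into `r`. In the first argument it says that the
multiplication `A ⊗ A → A` is natural for the crossings by `r`, so it need only be tested at
generators, where it is the product rule of `ρ'`. -/
theorem isMulBraiding_of_crossing (hι : Generates ι) (hρ : IsLeftCrossing ρ')
    {r : A →ₗ[k] A →ₗ[k] A ⊗[k] A} (hr : IsRightCrossing r)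
    (hrι : ∀ v a, r (ι v) a = ι.rTensor A (ρ' a v)) :
    IsMulBraiding (TensorProduct.lift r.flip) := by
  have curry_eq : TensorProduct.curry (TensorProduct.lift r.flip) = r.flip := by
    ext; simp
  constructor
  · rw [curry_eq]
    constructor
    · intro p
      suffices H : r.flip 1 = (TensorProduct.mk k A A).flip 1 from LinearMap.congr_fun H p
      refine hι.linearMap_ext ?_ (fun v => ?_) fun a b ha hb => ?_
      · simp [hr.one]
      · simp [hrι, hρ.one]
      · simp only [LinearMap.flip_apply, TensorProduct.mk_apply] at ha hb ⊢
        simp [hr.mul, ha, hb]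
    · intro a b c
      have key : ∀ a t, LinearMap.lTensor A (LinearMap.mul' k A) (slideRight r (a ⊗ₜ t)) =
          extendRight (r.flip a) t := by
        intro a t
        induction t using TensorProduct.induction_on with
        | zero => simp
        | add x y hx hy => simp only [map_add, TensorProduct.tmul_add, hx, hy]
        | tmul c b =>
          simp only [slideRight_tmul, extendRight_tmul, LinearMap.flip_apply]
          induction r c a using TensorProduct.induction_on with
          | zero => simp
          | add x y hx hy => simp only [map_add, TensorProduct.add_tmul, hx, hy]
          | tmul c a => simp
      have := (hr.tensor hr).natural hι hr (LinearMap.mul' k A) (fun v t => ?_) c (a ⊗ₜ b)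
      · simpa [key] using this
      · induction t using TensorProduct.induction_on with
        | zero => simp
        | add x y hx hy => simp only [map_add, hx, hy]
        | tmul a b =>
          simp only [LinearMap.mul'_apply, hrι, hρ.mul, crossTensorRight_tmul, key]
          induction ρ' b v using TensorProduct.induction_on with
          | zero => simp
          | add x y hx hy => simp only [map_add, hx, hy]
          | tmul v b =>
            simp [hrι, rTensor_lTensor_apply]
  · rw [curry_eq, LinearMap.flip_flip]
    exact hr

end Extension

/-! ### Existence and uniqueness of the extended braiding. -/

section FreeExtension

variable {k X V : Type*} [Field k] [AddCommGroup V] [Module k V] (b : Module.Basis X k V)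
  {τ : V ⊗[k] V →ₗ[k] V ⊗[k] V}

/-- These are the mixed braidings of `V` with the free algebra to which every multiplicative
extension of `τ` must restrict. -/
theorem exists_crossings (τ : V ⊗[k] V →ₗ[k] V ⊗[k] V) :
    ∃ (ρ : FreeNonassocAlgebra k X →ₗ[k] V →ₗ[k] FreeNonassocAlgebra k X ⊗[k] V)
      (ρ' : FreeNonassocAlgebra k X →ₗ[k] V →ₗ[k] V ⊗[k] FreeNonassocAlgebra k X),
      IsRightCrossing ρ ∧ (∀ v w, ρ (incl b w) v = (incl b).rTensor V (τ (v ⊗ₜ w))) ∧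
      IsLeftCrossing ρ' ∧ (∀ v w, ρ' (incl b v) w = (incl b).lTensor V (τ (v ⊗ₜ w))) := by
  obtain ⟨ρ, hρ, hρι⟩ := exists_rightCrossing b
    (TensorProduct.curry ((incl b).rTensor V ∘ₗ τ)).flip
  obtain ⟨ρ', hρ', hρι'⟩ := exists_leftCrossing b
    (TensorProduct.curry ((incl b).lTensor V ∘ₗ τ))
  exact ⟨ρ, ρ', hρ, fun v w => by simp [hρι], hρ', fun v w => by simp [hρι']⟩

theorem IsBraidedExtension.isMulBraiding {σ} (h : IsBraidedExtension b τ σ) : IsMulBraiding σ :=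
  ((isBraidedAlgebra_iff σ).1 h.braidedAlgebra).2

theorem IsBraidedExtension.apply_incl {σ} (h : IsBraidedExtension b τ σ) (v w : V) :
    σ (incl b v ⊗ₜ incl b w) = TensorProduct.map (incl b) (incl b) (τ (v ⊗ₜ w)) :=
  LinearMap.congr_fun h.extends_braiding (v ⊗ₜ w)

theorem existsUnique_isBraidedExtension (hτ : IsBraiding τ) :
    ∃! σ : FreeNonassocAlgebra k X ⊗[k] FreeNonassocAlgebra k X →ₗ[k]
      FreeNonassocAlgebra k X ⊗[k] FreeNonassocAlgebra k X, IsBraidedExtension b τ σ := by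
  have hι := generates_incl b
  obtain ⟨ρ, ρ', hρ, hρι, hρ', hρι'⟩ := exists_crossings b τ
  -- Second stage: the values of `r` on generators are the mixed braiding `ρ'`, included into `A ⊗
  -- A`.
  obtain ⟨r, hr, hrι⟩ := exists_rightCrossing b
    (LinearMap.llcomp k _ _ _ ((incl b).rTensor (FreeNonassocAlgebra k X)) ∘ₗ ρ'.flip)
  have hσ : IsMulBraiding (TensorProduct.lift r.flip) :=
    isMulBraiding_of_crossing hι hρ' hr fun v a => by simp [hrι]
  have hext : ∀ v w, TensorProduct.lift r.flip (incl b v ⊗ₜ incl b w) =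
      TensorProduct.map (incl b) (incl b) (τ (v ⊗ₜ w)) := fun v w => by
    simp only [TensorProduct.lift.tmul, LinearMap.flip_apply, hrι, LinearMap.comp_apply,
      LinearMap.llcomp_apply, hρι']
    rw [← LinearMap.comp_apply, LinearMap.rTensor_comp_lTensor]
  refine ⟨TensorProduct.lift r.flip, ⟨(isBraidedAlgebra_iff _).2 ⟨hσ.isBraiding hι hρ
    (hσ.incl_tmul hι hext hρ hρι) (hσ.tmul_incl hι hext hρ' hρι') hτ (TensorProduct.ext' hext), hσ⟩,
    TensorProduct.ext' hext⟩, fun σ h => ?_⟩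
  exact (h.isMulBraiding).eq_of_tmul_incl hι hσ fun a v => by
    rw [h.isMulBraiding.tmul_incl hι h.apply_incl hρ' hρι', hσ.tmul_incl hι hext hρ' hρι']

end FreeExtension

/-! ### Tensor products of algebras twisted by a crossing. -/

section CrossedMul

variable {k : Type*} [CommSemiring k]
  {P : Type*} [AddCommMonoid P] [Module k P] {Q : Type*} [AddCommMonoid Q] [Module k Q]
  {P' : Type*} [AddCommMonoid P'] [Module k P'] {Q' : Type*} [AddCommMonoid Q'] [Module k Q']

/-- The multiplication on `P ⊗ Q` given by multiplications on `P` and `Q` and a crossing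
`β : Q ⊗ P → P ⊗ Q`. -/
noncomputable def crossedMul (m : P ⊗[k] P →ₗ[k] P) (n : Q ⊗[k] Q →ₗ[k] Q)
    (β : Q ⊗[k] P →ₗ[k] P ⊗[k] Q) : (P ⊗[k] Q) ⊗[k] (P ⊗[k] Q) →ₗ[k] P ⊗[k] Q :=
  TensorProduct.map m n ∘ₗ
    (TensorProduct.tensorTensorTensorAssoc k P P Q Q).symm.toLinearMap ∘ₗ
    (β.lTensor P).rTensor Q ∘ₗ
    (TensorProduct.tensorTensorTensorAssoc k P Q P Q).toLinearMap

theorem crossedMul_tmul (m : P ⊗[k] P →ₗ[k] P) (n : Q ⊗[k] Q →ₗ[k] Q)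
    (β : Q ⊗[k] P →ₗ[k] P ⊗[k] Q) (a c : P) (b d : Q) :
    crossedMul m n β ((a ⊗ₜ b) ⊗ₜ (c ⊗ₜ d)) =
      TensorProduct.map (TensorProduct.curry m a) ((TensorProduct.curry n).flip d)
        (β (b ⊗ₜ c)) := by
  simp only [crossedMul, LinearMap.comp_apply, LinearEquiv.coe_coe,
    TensorProduct.tensorTensorTensorAssoc_tmul, LinearMap.rTensor_tmul, LinearMap.lTensor_tmul]
  induction β (b ⊗ₜ c) using TensorProduct.induction_on with
  | zero => simp
  | add x y hx hy => simp only [map_add, TensorProduct.add_tmul, TensorProduct.tmul_add, hx, hy]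
  | tmul x y => simp

/-- Allowing different factors and crossings lets this one statement cover `Δ ⊗ id`, `id ⊗ Δ`, `ε ⊗
id`, `id ⊗ ε` and `φ ⊗ φ`. -/
theorem map_crossedMul {m : P ⊗[k] P →ₗ[k] P} {n : Q ⊗[k] Q →ₗ[k] Q}
    {β : Q ⊗[k] P →ₗ[k] P ⊗[k] Q} {m' : P' ⊗[k] P' →ₗ[k] P'} {n' : Q' ⊗[k] Q' →ₗ[k] Q'}
    {β' : Q' ⊗[k] P' →ₗ[k] P' ⊗[k] Q'} {f : P →ₗ[k] P'} {g : Q →ₗ[k] Q'}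
    (hf : ∀ a c, f (m (a ⊗ₜ c)) = m' (f a ⊗ₜ f c)) (hg : ∀ b d, g (n (b ⊗ₜ d)) = n' (g b ⊗ₜ g d))
    (hβ : ∀ b c, TensorProduct.map f g (β (b ⊗ₜ c)) = β' (g b ⊗ₜ f c)) (s t : P ⊗[k] Q) :
    TensorProduct.map f g (crossedMul m n β (s ⊗ₜ t)) =
      crossedMul m' n' β' (TensorProduct.map f g s ⊗ₜ TensorProduct.map f g t) := by
  induction s using TensorProduct.induction_on with
  | zero => simp
  | add x y hx hy => simp only [map_add, TensorProduct.add_tmul, hx, hy]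
  | tmul a b =>
    induction t using TensorProduct.induction_on with
    | zero => simp
    | add x y hx hy => simp only [map_add, TensorProduct.tmul_add, hx, hy]
    | tmul c d =>
      simp only [TensorProduct.map_tmul, crossedMul_tmul, ← hβ]
      induction β (b ⊗ₜ c) using TensorProduct.induction_on with
      | zero => simp
      | add x y hx hy => simp only [map_add, hx, hy]
      | tmul x y => simp [hf, hg]

end CrossedMul

/-! ### The braided tensor square and its crossings with the algebra. -/

section Coproduct

variable {k : Type*} [CommSemiring k] {A : Type*} [NonAssocSemiring A] [Module k A]

/-- The crossing of the braided tensor square with `A` on the right of it. -/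
noncomputable def squareCrossRight (σ : A ⊗[k] A →ₗ[k] A ⊗[k] A) :
    (A ⊗[k] A) ⊗[k] A →ₗ[k] A ⊗[k] (A ⊗[k] A) :=
  (TensorProduct.assoc k A A A).toLinearMap ∘ₗ braid1 σ ∘ₗ braid2 σ

/-- The crossing of the braided tensor square with `A` on the left of it. -/
noncomputable def squareCrossLeft (σ : A ⊗[k] A →ₗ[k] A ⊗[k] A) :
    A ⊗[k] (A ⊗[k] A) →ₗ[k] (A ⊗[k] A) ⊗[k] A :=
  braid2 σ ∘ₗ braid1 σ ∘ₗ (TensorProduct.assoc k A A A).symm.toLinearMap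

theorem squareCrossRight_tmul (σ : A ⊗[k] A →ₗ[k] A ⊗[k] A) (a b c : A) :
    squareCrossRight σ ((a ⊗ₜ b) ⊗ₜ c) = TensorProduct.assoc k A A A
      (braid1 σ ((TensorProduct.assoc k A A A).symm (a ⊗ₜ σ (b ⊗ₜ c)))) := by
  simp [squareCrossRight]

theorem squareCrossLeft_tmul (σ : A ⊗[k] A →ₗ[k] A ⊗[k] A) (a b c : A) :
    squareCrossLeft σ (c ⊗ₜ (a ⊗ₜ b)) = braid2 σ (σ (c ⊗ₜ a) ⊗ₜ b) := by
  simp [squareCrossLeft]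

variable [IsScalarTower k A A] [SMulCommClass k A A] {σ : A ⊗[k] A →ₗ[k] A ⊗[k] A}

theorem braidedMul_eq (σ : A ⊗[k] A →ₗ[k] A ⊗[k] A) :
    braidedMul σ = crossedMul (LinearMap.mul' k A) (LinearMap.mul' k A) σ := rfl

theorem braidedMul_tmul (σ : A ⊗[k] A →ₗ[k] A ⊗[k] A) (a b c d : A) :
    braidedMul σ ((a ⊗ₜ b) ⊗ₜ (c ⊗ₜ d)) =
      TensorProduct.map (LinearMap.mulLeft k a) (LinearMap.mulRight k d) (σ (b ⊗ₜ c)) :=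
  crossedMul_tmul _ _ _ _ _ _ _

theorem IsMulBraiding.braidedMul_one_left (hσ : IsMulBraiding σ) (t : A ⊗[k] A) :
    braidedMul σ ((1 ⊗ₜ 1) ⊗ₜ t) = t := by
  induction t using TensorProduct.induction_on with
  | zero => simp
  | add x y hx hy => simp only [map_add, TensorProduct.tmul_add, hx, hy]
  | tmul c d => simp [braidedMul_tmul, hσ.one_tmul]

theorem IsMulBraiding.braidedMul_one_right (hσ : IsMulBraiding σ) (t : A ⊗[k] A) :
    braidedMul σ (t ⊗ₜ (1 ⊗ₜ 1)) = t := by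
  induction t using TensorProduct.induction_on with
  | zero => simp
  | add x y hx hy => simp only [map_add, TensorProduct.add_tmul, hx, hy]
  | tmul c d => simp [braidedMul_tmul, hσ.tmul_one]

/-- The map `u ⊗ (w ⊗ v) ↦ w' ⊗ u' v`, where `u ⊗ w ↦ w' ⊗ u'` is the crossing. -/
noncomputable def squareExtendRight (σ : A ⊗[k] A →ₗ[k] A ⊗[k] A) :
    (A ⊗[k] A) ⊗[k] (A ⊗[k] (A ⊗[k] A)) →ₗ[k] A ⊗[k] (A ⊗[k] A) :=
  (braidedMul σ).lTensor A ∘ₗ (TensorProduct.assoc k A (A ⊗[k] A) (A ⊗[k] A)).toLinearMap ∘ₗ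
    (squareCrossRight σ).rTensor (A ⊗[k] A) ∘ₗ
    (TensorProduct.assoc k (A ⊗[k] A) A (A ⊗[k] A)).symm.toLinearMap

/-- The map `(u ⊗ w) ⊗ v ↦ u v' ⊗ w'`, where `w ⊗ v ↦ v' ⊗ w'` is the crossing. -/
noncomputable def squareExtendLeft (σ : A ⊗[k] A →ₗ[k] A ⊗[k] A) :
    ((A ⊗[k] A) ⊗[k] A) ⊗[k] (A ⊗[k] A) →ₗ[k] (A ⊗[k] A) ⊗[k] A :=
  (braidedMul σ).rTensor A ∘ₗ (TensorProduct.assoc k (A ⊗[k] A) (A ⊗[k] A) A).symm.toLinearMap ∘ₗ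
    (squareCrossLeft σ).lTensor (A ⊗[k] A) ∘ₗ
    (TensorProduct.assoc k (A ⊗[k] A) A (A ⊗[k] A)).toLinearMap

theorem squareExtendRight_tmul (σ : A ⊗[k] A →ₗ[k] A ⊗[k] A) (u v : A ⊗[k] A) (w : A) :
    squareExtendRight σ (u ⊗ₜ (w ⊗ₜ v)) =
      ((TensorProduct.curry (braidedMul σ)).flip v).lTensor A (squareCrossRight σ (u ⊗ₜ w)) := by
  simp only [squareExtendRight, LinearMap.comp_apply, LinearEquiv.coe_coe,
    TensorProduct.assoc_symm_tmul, LinearMap.rTensor_tmul]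
  induction squareCrossRight σ (u ⊗ₜ w) using TensorProduct.induction_on with
  | zero => simp
  | add x y hx hy => simp only [map_add, TensorProduct.add_tmul, hx, hy]
  | tmul x y => simp

theorem squareExtendLeft_tmul (σ : A ⊗[k] A →ₗ[k] A ⊗[k] A) (u v : A ⊗[k] A) (w : A) :
    squareExtendLeft σ ((u ⊗ₜ w) ⊗ₜ v) =
      (TensorProduct.curry (braidedMul σ) u).rTensor A (squareCrossLeft σ (w ⊗ₜ v)) := by
  simp only [squareExtendLeft, LinearMap.comp_apply, LinearEquiv.coe_coe,
    TensorProduct.assoc_tmul, LinearMap.lTensor_tmul]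
  induction squareCrossLeft σ (w ⊗ₜ v) using TensorProduct.induction_on with
  | zero => simp
  | add x y hx hy => simp only [map_add, TensorProduct.tmul_add, hx, hy]
  | tmul x y => simp

/-- The map `(c ⊗ b) ⊗ (w ⊗ d) ↦ w' ⊗ a' c' ⊗ b' d`, where `w` passes to the left of `b`, `c`
and `a`. -/
noncomputable def squareAuxRight (σ : A ⊗[k] A →ₗ[k] A ⊗[k] A) (a : A) :
    (A ⊗[k] A) ⊗[k] (A ⊗[k] A) →ₗ[k] (A ⊗[k] A) ⊗[k] A :=
  TensorProduct.map (extendRight (TensorProduct.curry σ a)) (LinearMap.mul' k A) ∘ₗ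
    (TensorProduct.assoc k (A ⊗[k] A) A A).toLinearMap ∘ₗ
    (braid1 σ ∘ₗ braid2 σ).rTensor A ∘ₗ
    (TensorProduct.assoc k (A ⊗[k] A) A A).symm.toLinearMap

theorem IsMulBraiding.squareAuxRight_tmul (hσ : IsMulBraiding σ) (a d w : A) (r : A ⊗[k] A) :
    braid1 σ (braid2 σ (TensorProduct.map (LinearMap.mulLeft k a) (LinearMap.mulRight k d) r ⊗ₜ w))
      = squareAuxRight σ a (r ⊗ₜ σ (d ⊗ₜ w)) := by
  induction r using TensorProduct.induction_on with
  | zero => simp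
  | add x y hx hy => simp only [map_add, TensorProduct.add_tmul, hx, hy]
  | tmul c b =>
    simp only [TensorProduct.map_tmul, LinearMap.mulLeft_apply, LinearMap.mulRight_apply,
      braid2_tmul, hσ.mul_tmul]
    induction σ (d ⊗ₜ w) using TensorProduct.induction_on with
    | zero => simp
    | add x y hx hy => simp only [map_add, TensorProduct.tmul_add, hx, hy]
    | tmul w d =>
      simp only [squareAuxRight, LinearMap.comp_apply, LinearEquiv.coe_coe,
        TensorProduct.assoc_symm_tmul, LinearMap.rTensor_tmul, braid2_tmul, extendRight_tmul,
        TensorProduct.curry_apply]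
      induction σ (b ⊗ₜ w) using TensorProduct.induction_on with
      | zero => simp
      | add x y hx hy => simp only [map_add, TensorProduct.tmul_add, TensorProduct.add_tmul, hx, hy]
      | tmul w b => simp [hσ.mul_tmul]

/-- Moving `w` past a product in the braided square agrees with moving it past the two factors
successively: the braid relation slides `w` through the internal crossing of `b` with `c`. -/
theorem IsMulBraiding.squareCrossRight_braidedMul (hσ : IsMulBraiding σ) (hb : IsBraiding σ)
    (u v : A ⊗[k] A) (w : A) :
    squareCrossRight σ (braidedMul σ (u ⊗ₜ v) ⊗ₜ w) =
      squareExtendRight σ (u ⊗ₜ squareCrossRight σ (v ⊗ₜ w)) := by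
  induction u using TensorProduct.induction_on with
  | zero => simp
  | add x y hx hy => simp only [map_add, TensorProduct.add_tmul, hx, hy]
  | tmul a b =>
  induction v using TensorProduct.induction_on with
  | zero => simp
  | add x y hx hy => simp only [map_add, TensorProduct.add_tmul, TensorProduct.tmul_add, hx, hy]
  | tmul c d =>
  rw [braidedMul_tmul]
  change TensorProduct.assoc k A A A (braid1 σ (braid2 σ _)) = _
  rw [hσ.squareAuxRight_tmul, squareCrossRight_tmul]
  induction σ (d ⊗ₜ w) using TensorProduct.induction_on with
  | zero => simp
  | add x y hx hy => simp only [map_add, TensorProduct.tmul_add, hx, hy]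
  | tmul w d =>
  have hbraid : braid1 σ (braid2 σ (σ (b ⊗ₜ c) ⊗ₜ w)) =
      braid2 σ (braid1 σ ((TensorProduct.assoc k A A A).symm (b ⊗ₜ σ (c ⊗ₜ w)))) := by
    simpa using LinearMap.congr_fun hb ((b ⊗ₜ c) ⊗ₜ w)
  simp only [squareAuxRight, LinearMap.comp_apply, LinearEquiv.coe_coe,
    TensorProduct.assoc_symm_tmul, LinearMap.rTensor_tmul, hbraid, braid1_tmul]
  induction σ (c ⊗ₜ w) using TensorProduct.induction_on with
  | zero => simp
  | add x y hx hy => simp only [map_add, TensorProduct.add_tmul, TensorProduct.tmul_add, hx, hy]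
  | tmul w c =>
  simp only [TensorProduct.assoc_symm_tmul, TensorProduct.assoc_tmul, squareExtendRight_tmul,
    squareCrossRight_tmul, braid1_tmul]
  induction σ (b ⊗ₜ w) using TensorProduct.induction_on with
  | zero => simp
  | add x y hx hy => simp only [map_add, TensorProduct.add_tmul, TensorProduct.tmul_add, hx, hy]
  | tmul w b =>
  simp only [TensorProduct.assoc_symm_tmul, braid2_tmul, braid1_tmul]
  -- The remaining crossings `σ (a ⊗ₜ w)` and `σ (b ⊗ₜ c)` are independent; the middle term is
  -- bilinear in them, so each side can be expanded separately.
  trans ((TensorProduct.map (LinearMap.mul' k A) (LinearMap.mulRight k d) ∘ₗ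
    (TensorProduct.assoc k A A A).symm.toLinearMap).lTensor A)
      (TensorProduct.assoc k A A (A ⊗[k] A) (σ (a ⊗ₜ w) ⊗ₜ σ (b ⊗ₜ c)))
  · induction σ (b ⊗ₜ c) using TensorProduct.induction_on with
    | zero => simp
    | add x y hx hy => simp only [map_add, TensorProduct.add_tmul, TensorProduct.tmul_add, hx, hy]
    | tmul c b =>
      simp only [TensorProduct.assoc_symm_tmul, TensorProduct.assoc_tmul, TensorProduct.map_tmul,
        extendRight_tmul, TensorProduct.curry_apply, LinearMap.mul'_apply]
      induction σ (a ⊗ₜ w) using TensorProduct.induction_on with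
      | zero => simp
      | add x y hx hy => simp only [map_add, TensorProduct.add_tmul, hx, hy]
      | tmul w a => simp
  · induction σ (a ⊗ₜ w) using TensorProduct.induction_on with
    | zero => simp
    | add x y hx hy => simp only [map_add, TensorProduct.add_tmul, hx, hy]
    | tmul w a =>
      simp only [TensorProduct.assoc_tmul, LinearMap.lTensor_tmul, LinearMap.flip_apply,
        TensorProduct.curry_apply, braidedMul_tmul]
      congr 1
      induction σ (b ⊗ₜ c) using TensorProduct.induction_on with
      | zero => simp
      | add x y hx hy => simp only [map_add, TensorProduct.tmul_add, hx, hy]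
      | tmul c b => simp

end Coproduct

/-! ### Coproduct and counit: compatibility with the braiding, coassociativity and counit laws. -/

section Coproduct

variable {k : Type*} [CommSemiring k] {A : Type*} [NonAssocSemiring A] [Module k A]
  [IsScalarTower k A A] [SMulCommClass k A A] {V : Type*} [AddCommMonoid V] [Module k V]
  {ι : V →ₗ[k] A} {σ : A ⊗[k] A →ₗ[k] A ⊗[k] A}

/-- The map `(a ⊗ w) ⊗ (c ⊗ b) ↦ a c' ⊗ b' d' ⊗ w'`, where `w` passes to the right of `c`, `b`
and `d`. -/
noncomputable def squareAuxLeft (σ : A ⊗[k] A →ₗ[k] A ⊗[k] A) (d : A) :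
    (A ⊗[k] A) ⊗[k] (A ⊗[k] A) →ₗ[k] A ⊗[k] (A ⊗[k] A) :=
  TensorProduct.map (LinearMap.mul' k A) (extendLeft ((TensorProduct.curry σ).flip d)) ∘ₗ
    (TensorProduct.assoc k A A (A ⊗[k] A)).symm.toLinearMap ∘ₗ
    ((TensorProduct.assoc k A A A).toLinearMap ∘ₗ squareCrossLeft σ).lTensor A ∘ₗ
    (TensorProduct.assoc k A A (A ⊗[k] A)).toLinearMap

theorem IsMulBraiding.squareAuxLeft_tmul (hσ : IsMulBraiding σ) (a d w : A) (r : A ⊗[k] A) :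
    TensorProduct.assoc k A A A (squareCrossLeft σ
      (w ⊗ₜ TensorProduct.map (LinearMap.mulLeft k a) (LinearMap.mulRight k d) r))
      = squareAuxLeft σ d (σ (w ⊗ₜ a) ⊗ₜ r) := by
  induction r using TensorProduct.induction_on with
  | zero => simp
  | add x y hx hy => simp only [map_add, TensorProduct.tmul_add, hx, hy]
  | tmul c b =>
    simp only [TensorProduct.map_tmul, LinearMap.mulLeft_apply, LinearMap.mulRight_apply,
      squareCrossLeft_tmul, hσ.tmul_mul]
    induction σ (w ⊗ₜ a) using TensorProduct.induction_on with
    | zero => simp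
    | add x y hx hy => simp only [map_add, TensorProduct.add_tmul, hx, hy]
    | tmul a w =>
      simp only [squareAuxLeft, LinearMap.comp_apply, LinearEquiv.coe_coe,
        TensorProduct.assoc_tmul, LinearMap.lTensor_tmul, squareCrossLeft_tmul, extendLeft_tmul,
        LinearMap.flip_apply, TensorProduct.curry_apply]
      induction σ (w ⊗ₜ c) using TensorProduct.induction_on with
      | zero => simp
      | add x y hx hy => simp only [map_add, TensorProduct.tmul_add, TensorProduct.add_tmul, hx, hy]
      | tmul w b => simp [hσ.tmul_mul]

theorem IsMulBraiding.squareCrossLeft_braidedMul (hσ : IsMulBraiding σ) (hb : IsBraiding σ)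
    (u v : A ⊗[k] A) (w : A) :
    squareCrossLeft σ (w ⊗ₜ braidedMul σ (u ⊗ₜ v)) =
      squareExtendLeft σ (squareCrossLeft σ (w ⊗ₜ u) ⊗ₜ v) := by
  induction u using TensorProduct.induction_on with
  | zero => simp
  | add x y hx hy => simp only [map_add, TensorProduct.add_tmul, TensorProduct.tmul_add, hx, hy]
  | tmul a b =>
  induction v using TensorProduct.induction_on with
  | zero => simp
  | add x y hx hy => simp only [map_add, TensorProduct.tmul_add, hx, hy]
  | tmul c d =>
  apply (TensorProduct.assoc k A A A).injective
  rw [braidedMul_tmul, hσ.squareAuxLeft_tmul, squareCrossLeft_tmul]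
  induction σ (w ⊗ₜ a) using TensorProduct.induction_on with
  | zero => simp
  | add x y hx hy => simp only [map_add, TensorProduct.add_tmul, hx, hy]
  | tmul a w =>
  -- The only use of the braid relation here: `w` is slid through the crossing of `b` with `c`.
  have hbraid : squareCrossLeft σ (w ⊗ₜ σ (b ⊗ₜ c)) =
      braid1 σ (braid2 σ (σ (w ⊗ₜ b) ⊗ₜ c)) := by
    simpa [squareCrossLeft] using (LinearMap.congr_fun hb ((w ⊗ₜ b) ⊗ₜ c)).symm
  simp only [squareAuxLeft, LinearMap.comp_apply, LinearEquiv.coe_coe,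
    TensorProduct.assoc_tmul, LinearMap.lTensor_tmul, hbraid, braid2_tmul]
  induction σ (w ⊗ₜ b) using TensorProduct.induction_on with
  | zero => simp
  | add x y hx hy => simp only [map_add, TensorProduct.add_tmul, TensorProduct.tmul_add, hx, hy]
  | tmul b w =>
  simp only [TensorProduct.assoc_symm_tmul, squareExtendLeft_tmul,
    squareCrossLeft_tmul, braid2_tmul]
  induction σ (w ⊗ₜ c) using TensorProduct.induction_on with
  | zero => simp
  | add x y hx hy => simp only [map_add, TensorProduct.add_tmul, TensorProduct.tmul_add, hx, hy]
  | tmul c w =>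
  simp only [TensorProduct.assoc_symm_tmul, braid2_tmul, braid1_tmul]
  trans TensorProduct.map (LinearMap.mulLeft k a) (TensorProduct.map (LinearMap.mul' k A)
    LinearMap.id ∘ₗ (TensorProduct.assoc k A A A).symm.toLinearMap)
      (TensorProduct.assoc k A A (A ⊗[k] A) (σ (b ⊗ₜ c) ⊗ₜ σ (w ⊗ₜ d)))
  · induction σ (b ⊗ₜ c) using TensorProduct.induction_on with
    | zero => simp
    | add x y hx hy => simp only [map_add, TensorProduct.add_tmul, TensorProduct.tmul_add, hx, hy]
    | tmul c b =>
      simp only [TensorProduct.assoc_symm_tmul, TensorProduct.assoc_tmul, TensorProduct.map_tmul,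
        extendLeft_tmul, TensorProduct.curry_apply, LinearMap.mul'_apply, LinearMap.flip_apply]
      induction σ (w ⊗ₜ d) using TensorProduct.induction_on with
      | zero => simp
      | add x y hx hy => simp only [map_add, TensorProduct.tmul_add, hx, hy]
      | tmul w a => simp
  · induction σ (w ⊗ₜ d) using TensorProduct.induction_on with
    | zero => simp
    | add x y hx hy => simp only [map_add, TensorProduct.tmul_add, hx, hy]
    | tmul d w =>
      simp only [TensorProduct.assoc_symm_tmul, LinearMap.rTensor_tmul,
        TensorProduct.curry_apply, braidedMul_tmul]
      induction σ (b ⊗ₜ c) using TensorProduct.induction_on with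
      | zero => simp
      | add x y hx hy => simp only [map_add, TensorProduct.add_tmul, hx, hy]
      | tmul c b => simp

/-- `Δ : A → A ⊗̲ A` is a homomorphism of unital algebras for which the elements of `ι` are
primitive. -/
structure IsPrimitiveComul (ι : V →ₗ[k] A) (σ : A ⊗[k] A →ₗ[k] A ⊗[k] A)
    (Δ : A →ₗ[k] A ⊗[k] A) : Prop where
  one : Δ 1 = 1 ⊗ₜ 1
  mul : ∀ x y, Δ (x * y) = braidedMul σ (Δ x ⊗ₜ Δ y)
  prim : ∀ v, Δ (ι v) = ι v ⊗ₜ 1 + 1 ⊗ₜ ι v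

/-- `ε : A → k` is a homomorphism of unital algebras that vanishes on the elements of `ι`. -/
structure IsAugmentation (ι : V →ₗ[k] A) (ε : A →ₗ[k] k) : Prop where
  one : ε 1 = 1
  mul : ∀ x y, ε (x * y) = ε x * ε y
  incl : ∀ v, ε (ι v) = 0

variable {Δ : A →ₗ[k] A ⊗[k] A} {ε : A →ₗ[k] k} {ρ : A →ₗ[k] V →ₗ[k] A ⊗[k] V}
  {ρ' : A →ₗ[k] V →ₗ[k] V ⊗[k] A}

theorem IsPrimitiveComul.unique (hι : Generates ι) (hΔ : IsPrimitiveComul ι σ Δ)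
    {Δ' : A →ₗ[k] A ⊗[k] A} (hΔ' : IsPrimitiveComul ι σ Δ') : Δ = Δ' :=
  hι.linearMap_ext (by rw [hΔ.one, hΔ'.one]) (fun v => by rw [hΔ.prim, hΔ'.prim])
    fun a b ha hb => by rw [hΔ.mul, hΔ'.mul, ha, hb]

omit [IsScalarTower k A A] [SMulCommClass k A A] in
theorem IsAugmentation.unique (hι : Generates ι) (hε : IsAugmentation ι ε)
    {ε' : A →ₗ[k] k} (hε' : IsAugmentation ι ε') : ε = ε' :=
  hι.linearMap_ext (by rw [hε.one, hε'.one]) (fun v => by rw [hε.incl, hε'.incl])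
    fun a b ha hb => by rw [hε.mul, hε'.mul, ha, hb]

/-- As functions of `a` both sides obey the same product rule; on the right it is
`squareCrossRight_braidedMul`. On generators, `ρ` shows that the second factor of `σ (ι v ⊗ₜ b)` is
again a combination of primitive elements. -/
theorem IsPrimitiveComul.lTensor_braid (hι : Generates ι) (hσ : IsMulBraiding σ)
    (hb : IsBraiding σ) (hΔ : IsPrimitiveComul ι σ Δ)
    (hρσ : ∀ a v, σ (ι v ⊗ₜ a) = ι.lTensor A (ρ a v)) (a b : A) :
    Δ.lTensor A (σ (a ⊗ₜ b)) = squareCrossRight σ (Δ a ⊗ₜ b) := by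
  suffices H : TensorProduct.curry (Δ.lTensor A ∘ₗ σ) =
      TensorProduct.curry (squareCrossRight σ) ∘ₗ Δ from
    LinearMap.congr_fun (LinearMap.congr_fun H a) b
  refine hι.linearMap_ext (LinearMap.ext fun b => ?_) (fun v => LinearMap.ext fun b => ?_)
    fun x y hx hy => LinearMap.ext fun b => ?_
  · simp [hΔ.one, hσ.one_tmul, squareCrossRight_tmul]
  · change Δ.lTensor A (σ (ι v ⊗ₜ b)) = squareCrossRight σ (Δ (ι v) ⊗ₜ b)
    simp only [hΔ.prim, TensorProduct.add_tmul, map_add, squareCrossRight_tmul, hσ.one_tmul,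
      TensorProduct.assoc_symm_tmul, braid1_tmul, hρσ]
    induction ρ b v using TensorProduct.induction_on with
    | zero => simp
    | add x y hx hy =>
      simp only [map_add, TensorProduct.add_tmul, TensorProduct.tmul_add, hx, hy]
      abel
    | tmul a v => simp [hΔ.prim, hσ.one_tmul, TensorProduct.tmul_add]
  · replace hx : ∀ b, Δ.lTensor A (σ (x ⊗ₜ b)) = squareCrossRight σ (Δ x ⊗ₜ b) :=
      LinearMap.congr_fun hx
    replace hy : ∀ b, Δ.lTensor A (σ (y ⊗ₜ b)) = squareCrossRight σ (Δ y ⊗ₜ b) :=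
      LinearMap.congr_fun hy
    change Δ.lTensor A (σ ((x * y) ⊗ₜ b)) = squareCrossRight σ (Δ (x * y) ⊗ₜ b)
    rw [hΔ.mul, hσ.squareCrossRight_braidedMul hb, ← hy, hσ.mul_tmul]
    induction σ (y ⊗ₜ b) using TensorProduct.induction_on with
    | zero => simp
    | add s t hs ht => simp only [map_add, TensorProduct.tmul_add, hs, ht]
    | tmul w c =>
      rw [extendRight_tmul, LinearMap.lTensor_tmul, squareExtendRight_tmul, ← hx,
        TensorProduct.curry_apply]
      induction σ (x ⊗ₜ w) using TensorProduct.induction_on with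
      | zero => simp
      | add s t hs ht => simp only [map_add, hs, ht]
      | tmul w d => simp [hΔ.mul]

theorem IsPrimitiveComul.rTensor_braid (hι : Generates ι) (hσ : IsMulBraiding σ)
    (hb : IsBraiding σ) (hΔ : IsPrimitiveComul ι σ Δ)
    (hρσ : ∀ a v, σ (a ⊗ₜ ι v) = ι.rTensor A (ρ' a v)) (a b : A) :
    Δ.rTensor A (σ (a ⊗ₜ b)) = squareCrossLeft σ (a ⊗ₜ Δ b) := by
  suffices H : (TensorProduct.curry (Δ.rTensor A ∘ₗ σ)).flip =
      (TensorProduct.curry (squareCrossLeft σ)).flip ∘ₗ Δ from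
    LinearMap.congr_fun (LinearMap.congr_fun H b) a
  refine hι.linearMap_ext (LinearMap.ext fun b => ?_) (fun v => LinearMap.ext fun b => ?_)
    fun x y hx hy => LinearMap.ext fun b => ?_
  · simp [hΔ.one, hσ.tmul_one, squareCrossLeft_tmul]
  · change Δ.rTensor A (σ (b ⊗ₜ ι v)) = squareCrossLeft σ (b ⊗ₜ Δ (ι v))
    simp only [hΔ.prim, TensorProduct.tmul_add, map_add, squareCrossLeft_tmul, hσ.tmul_one,
      braid2_tmul, hρσ]
    induction ρ' b v using TensorProduct.induction_on with
    | zero => simp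
    | add x y hx hy =>
      simp only [map_add, TensorProduct.add_tmul, TensorProduct.tmul_add, hx, hy]
      abel
    | tmul a v => simp [hΔ.prim, hσ.tmul_one, TensorProduct.add_tmul]
  · replace hx : ∀ b, Δ.rTensor A (σ (b ⊗ₜ x)) = squareCrossLeft σ (b ⊗ₜ Δ x) :=
      LinearMap.congr_fun hx
    replace hy : ∀ b, Δ.rTensor A (σ (b ⊗ₜ y)) = squareCrossLeft σ (b ⊗ₜ Δ y) :=
      LinearMap.congr_fun hy
    change Δ.rTensor A (σ (b ⊗ₜ (x * y))) = squareCrossLeft σ (b ⊗ₜ Δ (x * y))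
    rw [hΔ.mul, hσ.squareCrossLeft_braidedMul hb, ← hx, hσ.tmul_mul]
    induction σ (b ⊗ₜ x) using TensorProduct.induction_on with
    | zero => simp
    | add s t hs ht => simp only [map_add, TensorProduct.add_tmul, hs, ht]
    | tmul c w =>
      rw [extendLeft_tmul, LinearMap.rTensor_tmul, squareExtendLeft_tmul, ← hy,
        LinearMap.flip_apply, TensorProduct.curry_apply]
      induction σ (w ⊗ₜ y) using TensorProduct.induction_on with
      | zero => simp
      | add s t hs ht => simp only [map_add, hs, ht]
      | tmul w d => simp [hΔ.mul]

/-- For `b` a generator both sides vanish, since the crossing leaves a generator in the factor to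
which `ε` is applied. Products follow from multiplicativity of `ε`. -/
theorem IsAugmentation.rTensor_braid (hι : Generates ι) (hσ : IsMulBraiding σ)
    (hε : IsAugmentation ι ε) (hρσ : ∀ a v, σ (a ⊗ₜ ι v) = ι.rTensor A (ρ' a v)) (a b : A) :
    ε.rTensor A (σ (a ⊗ₜ b)) = ε b ⊗ₜ a := by
  suffices H : (TensorProduct.curry (ε.rTensor A ∘ₗ σ)).flip = TensorProduct.mk k k A ∘ₗ ε from
    LinearMap.congr_fun (LinearMap.congr_fun H b) a
  refine hι.linearMap_ext (LinearMap.ext fun a => ?_) (fun v => LinearMap.ext fun a => ?_)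
    fun x y hx hy => LinearMap.ext fun a => ?_
  · simp [hσ.tmul_one]
  · simp only [TensorProduct.curry_apply, LinearMap.comp_apply, LinearMap.flip_apply, hρσ, hε.incl,
      map_zero, LinearMap.zero_apply]
    induction ρ' a v using TensorProduct.induction_on with
    | zero => simp
    | add x y hx hy => simp only [map_add, hx, hy, add_zero]
    | tmul a v => simp [hε.incl]
  · replace hx : ∀ a, ε.rTensor A (σ (a ⊗ₜ x)) = ε x ⊗ₜ a := LinearMap.congr_fun hx
    replace hy : ∀ a, ε.rTensor A (σ (a ⊗ₜ y)) = ε y ⊗ₜ a := LinearMap.congr_fun hy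
    change ε.rTensor A (σ (a ⊗ₜ (x * y))) = ε (x * y) ⊗ₜ a
    rw [hσ.tmul_mul, hε.mul]
    trans (LinearMap.mulRight k (ε y)).rTensor A (ε.rTensor A (σ (a ⊗ₜ x)))
    · induction σ (a ⊗ₜ x) using TensorProduct.induction_on with
      | zero => simp
      | add s t hs ht => simp only [map_add, hs, ht]
      | tmul c w =>
        trans (LinearMap.mulLeft k (ε c)).rTensor A (ε.rTensor A (σ (w ⊗ₜ y)))
        · rw [extendLeft_tmul, LinearMap.flip_apply, TensorProduct.curry_apply]
          induction σ (w ⊗ₜ y) using TensorProduct.induction_on with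
          | zero => simp
          | add s t hs ht => simp only [map_add, hs, ht]
          | tmul c w => simp [hε.mul]
        · simp [hy]
    · simp [hx]

theorem IsAugmentation.lTensor_braid (hι : Generates ι) (hσ : IsMulBraiding σ)
    (hε : IsAugmentation ι ε) (hρσ : ∀ a v, σ (ι v ⊗ₜ a) = ι.lTensor A (ρ a v)) (a b : A) :
    ε.lTensor A (σ (a ⊗ₜ b)) = b ⊗ₜ ε a := by
  suffices H : TensorProduct.curry (ε.lTensor A ∘ₗ σ) = (TensorProduct.mk k A k).flip ∘ₗ ε from
    LinearMap.congr_fun (LinearMap.congr_fun H a) b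
  refine hι.linearMap_ext (LinearMap.ext fun a => ?_) (fun v => LinearMap.ext fun a => ?_)
    fun x y hx hy => LinearMap.ext fun a => ?_
  · simp [hσ.one_tmul]
  · simp only [TensorProduct.curry_apply, LinearMap.comp_apply, hρσ, hε.incl,
      map_zero, LinearMap.zero_apply]
    induction ρ a v using TensorProduct.induction_on with
    | zero => simp
    | add x y hx hy => simp only [map_add, hx, hy, add_zero]
    | tmul a v => simp [hε.incl]
  · replace hx : ∀ a, ε.lTensor A (σ (x ⊗ₜ a)) = a ⊗ₜ ε x := LinearMap.congr_fun hx
    replace hy : ∀ a, ε.lTensor A (σ (y ⊗ₜ a)) = a ⊗ₜ ε y := LinearMap.congr_fun hy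
    change ε.lTensor A (σ ((x * y) ⊗ₜ a)) = a ⊗ₜ ε (x * y)
    rw [hσ.mul_tmul, hε.mul]
    trans (LinearMap.mulLeft k (ε x)).lTensor A (ε.lTensor A (σ (y ⊗ₜ a)))
    · induction σ (y ⊗ₜ a) using TensorProduct.induction_on with
      | zero => simp
      | add s t hs ht => simp only [map_add, hs, ht]
      | tmul w c =>
        trans (LinearMap.mulRight k (ε c)).lTensor A (ε.lTensor A (σ (x ⊗ₜ w)))
        · rw [extendRight_tmul, TensorProduct.curry_apply]
          induction σ (x ⊗ₜ w) using TensorProduct.induction_on with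
          | zero => simp
          | add s t hs ht => simp only [map_add, hs, ht]
          | tmul c w => simp [hε.mul]
        · simp [hx]
    · simp [hy]

/-- Both products on the triple tensor power use the same three crossings: first `c` past `d`, then
`b` past `d` and `c` past `e`, which are independent. Hence nothing is required of `σ`. -/
theorem assoc_crossedMul (σ : A ⊗[k] A →ₗ[k] A ⊗[k] A) (s t : (A ⊗[k] A) ⊗[k] A) :
    TensorProduct.assoc k A A A
        (crossedMul (braidedMul σ) (LinearMap.mul' k A) (squareCrossLeft σ) (s ⊗ₜ t)) =
      crossedMul (LinearMap.mul' k A) (braidedMul σ) (squareCrossRight σ)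
        (TensorProduct.assoc k A A A s ⊗ₜ TensorProduct.assoc k A A A t) := by
  suffices H : TensorProduct.curry ((TensorProduct.assoc k A A A).toLinearMap ∘ₗ
        crossedMul (braidedMul σ) (LinearMap.mul' k A) (squareCrossLeft σ)) =
      (TensorProduct.curry (crossedMul (LinearMap.mul' k A) (braidedMul σ)
        (squareCrossRight σ))).compl₁₂ (TensorProduct.assoc k A A A).toLinearMap
        (TensorProduct.assoc k A A A).toLinearMap from
    LinearMap.congr_fun (LinearMap.congr_fun H s) t
  refine TensorProduct.ext_threefold fun a b c => TensorProduct.ext_threefold fun d e f => ?_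
  simp only [TensorProduct.curry_apply, LinearMap.comp_apply, LinearMap.compl₁₂_apply,
    LinearEquiv.coe_coe, TensorProduct.assoc_tmul, crossedMul_tmul, squareCrossLeft_tmul,
    squareCrossRight_tmul]
  induction σ (c ⊗ₜ d) using TensorProduct.induction_on with
  | zero => simp
  | add x y hx hy => simp only [map_add, TensorProduct.add_tmul, TensorProduct.tmul_add, hx, hy]
  | tmul d c =>
  simp only [braid2_tmul, TensorProduct.assoc_symm_tmul, braid1_tmul]
  trans TensorProduct.map (LinearMap.mulLeft k a) (TensorProduct.map (LinearMap.mul' k A)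
    (LinearMap.mulRight k f) ∘ₗ (TensorProduct.assoc k A A A).symm.toLinearMap)
      (TensorProduct.assoc k A A (A ⊗[k] A) (σ (b ⊗ₜ d) ⊗ₜ σ (c ⊗ₜ e)))
  · induction σ (c ⊗ₜ e) using TensorProduct.induction_on with
    | zero => simp
    | add x y hx hy => simp only [map_add, TensorProduct.tmul_add, hx, hy]
    | tmul e c =>
      simp only [TensorProduct.assoc_symm_tmul, TensorProduct.map_tmul, TensorProduct.curry_apply,
        LinearMap.flip_apply, LinearMap.mul'_apply, braidedMul_tmul]
      induction σ (b ⊗ₜ d) using TensorProduct.induction_on with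
      | zero => simp
      | add x y hx hy => simp only [map_add, TensorProduct.add_tmul, hx, hy]
      | tmul d b => simp
  · induction σ (b ⊗ₜ d) using TensorProduct.induction_on with
    | zero => simp
    | add x y hx hy => simp only [map_add, TensorProduct.add_tmul, hx, hy]
    | tmul d b =>
      simp only [TensorProduct.assoc_tmul, TensorProduct.map_tmul, TensorProduct.curry_apply,
        LinearMap.flip_apply, LinearMap.mul'_apply, braidedMul_tmul, LinearMap.mulLeft_apply]
      congr 1
      induction σ (c ⊗ₜ e) using TensorProduct.induction_on with
      | zero => simp
      | add x y hx hy => simp only [map_add, TensorProduct.tmul_add, hx, hy]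
      | tmul e c => simp

/-- Compatibility of `Δ` with the braiding makes `Δ ⊗ id` and `id ⊗ Δ` multiplicative for the
crossed products, which the associator identifies. Both sides are then homomorphisms that agree on
generators. -/
theorem IsPrimitiveComul.coassoc (hι : Generates ι) (hσ : IsMulBraiding σ)
    (hb : IsBraiding σ) (hΔ : IsPrimitiveComul ι σ Δ)
    (hρσ : ∀ a v, σ (ι v ⊗ₜ a) = ι.lTensor A (ρ a v))
    (hρσ' : ∀ a v, σ (a ⊗ₜ ι v) = ι.rTensor A (ρ' a v)) :
    (TensorProduct.assoc k A A A).toLinearMap ∘ₗ Δ.rTensor A ∘ₗ Δ = Δ.lTensor A ∘ₗ Δ := by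
  refine hι.linearMap_ext (by simp [hΔ.one]) (fun v => ?_) fun x y hx hy => ?_
  · simp [hΔ.one, hΔ.prim, TensorProduct.add_tmul, TensorProduct.tmul_add, add_assoc]
  · simp only [LinearMap.comp_apply, LinearEquiv.coe_coe, hΔ.mul, braidedMul_eq] at hx hy ⊢
    have hr := map_crossedMul (f := Δ) (g := LinearMap.id) (m := LinearMap.mul' k A)
      (n := LinearMap.mul' k A) (β := σ) (m' := braidedMul σ) (n' := LinearMap.mul' k A)
      (β' := squareCrossLeft σ) (fun a c => hΔ.mul a c) (fun _ _ => rfl)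
      (hΔ.rTensor_braid hι hσ hb hρσ') (Δ x) (Δ y)
    have hl := map_crossedMul (f := LinearMap.id) (g := Δ) (m := LinearMap.mul' k A)
      (n := LinearMap.mul' k A) (β := σ) (m' := LinearMap.mul' k A) (n' := braidedMul σ)
      (β' := squareCrossRight σ) (fun _ _ => rfl) (fun a c => hΔ.mul a c)
      (hΔ.lTensor_braid hι hσ hb hρσ) (Δ x) (Δ y)
    change TensorProduct.assoc k A A A (TensorProduct.map Δ LinearMap.id _) =
      TensorProduct.map LinearMap.id Δ _
    rw [hr, hl, assoc_crossedMul]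
    exact congrArg₂ (fun s t => crossedMul _ _ _ (s ⊗ₜ t)) hx hy

theorem IsPrimitiveComul.rTensor_counit (hι : Generates ι) (hσ : IsMulBraiding σ)
    (hΔ : IsPrimitiveComul ι σ Δ) (hε : IsAugmentation ι ε)
    (hρσ' : ∀ a v, σ (a ⊗ₜ ι v) = ι.rTensor A (ρ' a v)) :
    ε.rTensor A ∘ₗ Δ = TensorProduct.mk k k A 1 := by
  refine hι.linearMap_ext (by simp [hΔ.one, hε.one]) (fun v => ?_) fun x y hx hy => ?_
  · simp [hΔ.prim, hε.one, hε.incl]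
  -- Applying `ε` to one strand turns the braiding into the ordinary flip `A ⊗ k → k ⊗ A`.
  · have := map_crossedMul (f := ε) (g := LinearMap.id) (m := LinearMap.mul' k A)
      (n := LinearMap.mul' k A) (β := σ) (m' := LinearMap.mul' k k) (n' := LinearMap.mul' k A)
      (β' := (TensorProduct.comm k A k).toLinearMap) (fun a c => hε.mul a c) (fun _ _ => rfl)
      (hε.rTensor_braid hι hσ hρσ') (Δ x) (Δ y)
    rw [LinearMap.comp_apply, hΔ.mul]
    refine (this.trans (congrArg₂ (fun s t => crossedMul _ _ _ (s ⊗ₜ t)) hx hy)).trans ?_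
    simp [crossedMul_tmul]

theorem IsPrimitiveComul.lTensor_counit (hι : Generates ι) (hσ : IsMulBraiding σ)
    (hΔ : IsPrimitiveComul ι σ Δ) (hε : IsAugmentation ι ε)
    (hρσ : ∀ a v, σ (ι v ⊗ₜ a) = ι.lTensor A (ρ a v)) :
    ε.lTensor A ∘ₗ Δ = (TensorProduct.mk k A k).flip 1 := by
  refine hι.linearMap_ext (by simp [hΔ.one, hε.one]) (fun v => ?_) fun x y hx hy => ?_
  · simp [hΔ.prim, hε.one, hε.incl]
  · have := map_crossedMul (f := LinearMap.id) (g := ε) (m := LinearMap.mul' k A)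
      (n := LinearMap.mul' k A) (β := σ) (m' := LinearMap.mul' k A) (n' := LinearMap.mul' k k)
      (β' := (TensorProduct.comm k k A).toLinearMap) (fun _ _ => rfl) (fun a c => hε.mul a c)
      (hε.lTensor_braid hι hσ hρσ) (Δ x) (Δ y)
    rw [LinearMap.comp_apply, hΔ.mul]
    refine (this.trans (congrArg₂ (fun s t => crossedMul _ _ _ (s ⊗ₜ t)) hx hy)).trans ?_
    simp [crossedMul_tmul]

/-- An algebra endomorphism that scales the generators commutes with the braiding. -/
theorem IsMulBraiding.map_braid (hι : Generates ι) (hσ : IsMulBraiding σ)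
    (hρσ : ∀ a v, σ (ι v ⊗ₜ a) = ι.lTensor A (ρ a v))
    (hρσ' : ∀ a v, σ (a ⊗ₜ ι v) = ι.rTensor A (ρ' a v)) {φ : A →ₗ[k] A} (r : k) (h1 : φ 1 = 1)
    (hmul : ∀ a b, φ (a * b) = φ a * φ b) (hφ : ∀ v, φ (ι v) = r • ι v) (a b : A) :
    TensorProduct.map φ φ (σ (a ⊗ₜ b)) = σ (φ a ⊗ₜ φ b) := by
  -- The endomorphism slides along one strand at a time. On a generator this works because `φ` is
  -- the scalar `r` on all generators, and crossing returns a generator on that strand.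
  have hleft : ∀ a b, σ (φ a ⊗ₜ b) = φ.lTensor A (σ (a ⊗ₜ b)) := by
    intro a b
    suffices H : TensorProduct.curry σ ∘ₗ φ = TensorProduct.curry (φ.lTensor A ∘ₗ σ) from
      LinearMap.congr_fun (LinearMap.congr_fun H a) b
    refine hι.linearMap_ext (LinearMap.ext fun b => ?_) (fun v => LinearMap.ext fun b => ?_)
      fun x y hx hy => LinearMap.ext fun b => ?_
    · simp [h1, hσ.one_tmul]
    · simp only [LinearMap.comp_apply, hφ, TensorProduct.curry_apply, map_smul,
        LinearMap.smul_apply, hρσ]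
      induction ρ b v using TensorProduct.induction_on with
      | zero => simp
      | add x y hx hy => simp only [map_add, smul_add, hx, hy]
      | tmul a v => simp [hφ]
    · replace hx : ∀ b, σ (φ x ⊗ₜ b) = φ.lTensor A (σ (x ⊗ₜ b)) := LinearMap.congr_fun hx
      replace hy : ∀ b, σ (φ y ⊗ₜ b) = φ.lTensor A (σ (y ⊗ₜ b)) := LinearMap.congr_fun hy
      change σ (φ (x * y) ⊗ₜ b) = φ.lTensor A (σ ((x * y) ⊗ₜ b))
      rw [hmul, hσ.mul_tmul, hσ.mul_tmul, hy]
      induction σ (y ⊗ₜ b) using TensorProduct.induction_on with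
      | zero => simp
      | add s t hs ht => simp only [map_add, hs, ht]
      | tmul w c =>
        simp only [LinearMap.lTensor_tmul, extendRight_tmul, TensorProduct.curry_apply, hx]
        induction σ (x ⊗ₜ w) using TensorProduct.induction_on with
        | zero => simp
        | add s t hs ht => simp only [map_add, hs, ht]
        | tmul w c => simp [hmul]
  have hright : ∀ a b, σ (a ⊗ₜ φ b) = φ.rTensor A (σ (a ⊗ₜ b)) := by
    intro a b
    suffices H : (TensorProduct.curry σ).flip ∘ₗ φ =
        (TensorProduct.curry (φ.rTensor A ∘ₗ σ)).flip from
      LinearMap.congr_fun (LinearMap.congr_fun H b) a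
    refine hι.linearMap_ext (LinearMap.ext fun b => ?_) (fun v => LinearMap.ext fun b => ?_)
      fun x y hx hy => LinearMap.ext fun b => ?_
    · simp [h1, hσ.tmul_one]
    · simp only [LinearMap.comp_apply, hφ, TensorProduct.curry_apply, LinearMap.flip_apply,
        map_smul, LinearMap.smul_apply, hρσ']
      induction ρ' b v using TensorProduct.induction_on with
      | zero => simp
      | add x y hx hy => simp only [map_add, smul_add, hx, hy]
      | tmul a v => simp [hφ, TensorProduct.smul_tmul']
    · replace hx : ∀ b, σ (b ⊗ₜ φ x) = φ.rTensor A (σ (b ⊗ₜ x)) := LinearMap.congr_fun hx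
      replace hy : ∀ b, σ (b ⊗ₜ φ y) = φ.rTensor A (σ (b ⊗ₜ y)) := LinearMap.congr_fun hy
      change σ (b ⊗ₜ φ (x * y)) = φ.rTensor A (σ (b ⊗ₜ (x * y)))
      rw [hmul, hσ.tmul_mul, hσ.tmul_mul, hx]
      induction σ (b ⊗ₜ x) using TensorProduct.induction_on with
      | zero => simp
      | add s t hs ht => simp only [map_add, hs, ht]
      | tmul w c =>
        simp only [LinearMap.rTensor_tmul, extendLeft_tmul, TensorProduct.curry_apply,
          LinearMap.flip_apply, hy]
        induction σ (c ⊗ₜ y) using TensorProduct.induction_on with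
        | zero => simp
        | add s t hs ht => simp only [map_add, hs, ht]
        | tmul w c => simp [hmul]
  rw [hleft, hright, ← LinearMap.lTensor_comp_rTensor, LinearMap.comp_apply]

theorem IsPrimitiveComul.map_comul (hι : Generates ι) (hσ : IsMulBraiding σ)
    (hΔ : IsPrimitiveComul ι σ Δ) (hρσ : ∀ a v, σ (ι v ⊗ₜ a) = ι.lTensor A (ρ a v))
    (hρσ' : ∀ a v, σ (a ⊗ₜ ι v) = ι.rTensor A (ρ' a v)) {φ : A →ₗ[k] A} (r : k) (h1 : φ 1 = 1)
    (hmul : ∀ a b, φ (a * b) = φ a * φ b) (hφ : ∀ v, φ (ι v) = r • ι v) (a : A) :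
    TensorProduct.map φ φ (Δ a) = Δ (φ a) := by
  suffices H : TensorProduct.map φ φ ∘ₗ Δ = Δ ∘ₗ φ from LinearMap.congr_fun H a
  refine hι.linearMap_ext (by simp [h1, hΔ.one]) (fun v => ?_) fun x y hx hy => ?_
  · simp [hΔ.prim, hφ, h1, TensorProduct.smul_tmul']
  · rw [LinearMap.comp_apply] at hx hy
    rw [LinearMap.comp_apply, LinearMap.comp_apply, hmul, hΔ.mul, hΔ.mul, ← LinearMap.comp_apply Δ,
      ← LinearMap.comp_apply Δ, ← hx, ← hy]
    exact map_crossedMul hmul hmul (hσ.map_braid hι hρσ hρσ' r h1 hmul hφ) _ _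

end Coproduct

/-! ### Convolution inverses by locally finite geometric series. -/

section Convolution

open WithConv

variable {k : Type*} [CommRing k] {C : Type*} [AddCommGroup C] [Module k C] [Coalgebra k C]
  {B : Type*} [Ring B] [Algebra k B] {W : Type*}

theorem conv_apply_eq_of_mem_span {f f' g g' : C →ₗ[k] B} {s : Set (W × W)}
    (β : Module.Basis W k C) {c : C}
    (hc : Coalgebra.comul (R := k) c ∈ Submodule.span k (β.tensorProduct β '' s))
    (h : ∀ p ∈ s, f (β p.1) * g (β p.2) = f' (β p.1) * g' (β p.2)) :
    (toConv f * toConv g) c = (toConv f' * toConv g') c := by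
  simp only [LinearMap.convMul_apply]
  refine LinearMap.eqOn_span (f := LinearMap.mul' k B ∘ₗ TensorProduct.map f g)
    (g := LinearMap.mul' k B ∘ₗ TensorProduct.map f' g') ?_ hc
  rintro _ ⟨p, hp, rfl⟩
  simpa [Module.Basis.tensorProduct_apply'] using h p hp

/-- In a coalgebra with a homogeneous basis, the convolution powers of a map that vanishes in
degree zero are locally nilpotent. -/
theorem conv_pow_apply_eq_zero (β : Module.Basis W k C) (deg : W → ℕ)
    (hdeg : ∀ w, Coalgebra.comul (R := k) (β w) ∈
      Submodule.span k (β.tensorProduct β '' {p | deg p.1 + deg p.2 = deg w}))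
    (N : WithConv (C →ₗ[k] B)) (hN : ∀ w, deg w = 0 → N (β w) = 0) (n : ℕ) (w : W)
    (hw : deg w < n) : (N ^ n) (β w) = 0 := by
  induction n generalizing w with
  | zero => exact absurd hw (Nat.not_lt_zero _)
  | succ n ih =>
    rw [pow_succ']
    refine (conv_apply_eq_of_mem_span (f := N.ofConv) (g := (N ^ n).ofConv) (f' := 0) (g' := 0) β
      (hdeg w) fun p hp => ?_).trans (by simp)
    rw [LinearMap.zero_apply, zero_mul]
    simp only [Set.mem_ofPred_eq] at hp
    -- Either `N` kills the first factor, or the second has degree strictly below `deg w`, hence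
    -- below `n`, and `N ^ n` kills it.
    by_cases h0 : deg p.1 = 0
    · exact (congrArg (· * _) (hN p.1 h0)).trans (zero_mul _)
    · exact (congrArg (_ * ·) (ih p.2 (by omega))).trans (mul_zero _)

/-- In a coalgebra with a homogeneous basis, a linear map that agrees with the convolution unit in
degree zero is invertible for the convolution. -/
theorem exists_conv_inverse (β : Module.Basis W k C) (deg : W → ℕ)
    (hdeg : ∀ w, Coalgebra.comul (R := k) (β w) ∈
      Submodule.span k (β.tensorProduct β '' {p | deg p.1 + deg p.2 = deg w}))
    (f : WithConv (C →ₗ[k] B))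
    (hf : ∀ w, deg w = 0 → f (β w) = (1 : WithConv (C →ₗ[k] B)) (β w)) :
    ∃ g : WithConv (C →ₗ[k] B), g * f = 1 ∧ f * g = 1 := by
  let N : WithConv (C →ₗ[k] B) := 1 - f
  have hfN : f = 1 - N := by simp [N]
  have hN := conv_pow_apply_eq_zero β deg hdeg N fun w hw => by
    change (1 : WithConv (C →ₗ[k] B)) (β w) - f (β w) = 0
    rw [hf w hw, sub_self]
  let S : ℕ → WithConv (C →ₗ[k] B) := fun n => ∑ i ∈ Finset.range n, N ^ i
  have hS : ∀ (w : W) (n : ℕ), deg w < n → S n (β w) = S (deg w + 1) (β w) := by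
    intro w n hn
    induction n, hn using Nat.le_induction with
    | base => rfl
    | succ n hn ih =>
      rw [← ih]
      simp only [S, Finset.sum_range_succ]
      change S n (β w) + (N ^ n) (β w) = S n (β w)
      rw [hN n w hn, add_zero]
  have hone : ∀ w, (1 - N ^ (deg w + 1)) (β w) = (1 : WithConv (C →ₗ[k] B)) (β w) := fun w => by
    change (1 : WithConv (C →ₗ[k] B)) (β w) - (N ^ (deg w + 1)) (β w) = _
    rw [hN _ w (Nat.lt_succ_self _), sub_zero]
  -- The sum of all powers of `N = 1 - f`: on `β w` the partial sums are constant once more than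
  -- `deg w` terms are taken.
  let g : C →ₗ[k] B := β.constr k fun w => S (deg w + 1) (β w)
  have hg : ∀ w n, deg w < n → g (β w) = S n (β w) := fun w n hn => by
    rw [hS w n hn]
    exact β.constr_basis k _ w
  refine ⟨toConv g, ?_, ?_⟩
  · apply WithConv.ofConv_injective
    refine β.ext fun w => ?_
    -- Both factors of the coproduct have degree at most `deg w`, so `g` may be replaced by one
    -- fixed partial sum; the finite geometric identity then leaves an error `N ^ (deg w + 1)` that
    -- vanishes on `β w`.
    refine (conv_apply_eq_of_mem_span (f := g) (g := f.ofConv) (f' := (S (deg w + 1)).ofConv)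
      (g' := f.ofConv) β (hdeg w) fun p hp => ?_).trans ?_
    · simp only [Set.mem_ofPred_eq] at hp
      rw [hg p.1 (deg w + 1) (by omega)]
    · refine (congrArg (fun F : WithConv (C →ₗ[k] B) => F (β w)) ?_).trans (hone w)
      rw [← geom_sum_mul_neg, ← hfN]
  · apply WithConv.ofConv_injective
    refine β.ext fun w => ?_
    refine (conv_apply_eq_of_mem_span (f := f.ofConv) (g := g) (f' := f.ofConv)
      (g' := (S (deg w + 1)).ofConv) β (hdeg w) fun p hp => ?_).trans ?_
    · simp only [Set.mem_ofPred_eq] at hp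
      rw [hg p.2 (deg w + 1) (by omega)]
    · refine (congrArg (fun F : WithConv (C →ₗ[k] B) => F (β w)) ?_).trans (hone w)
      rw [← mul_neg_geom_sum, ← hfN]

/-- An eigenvector of a diagonal map lies in the span of the basis vectors with its eigenvalue. -/
theorem mem_span_of_eigenvector {k M W : Type*} [Field k] [AddCommGroup M] [Module k M]
    (β : Module.Basis W k M) {ψ : M →ₗ[k] M} {c : W → k} (hψ : ∀ w, ψ (β w) = c w • β w) {r : k}
    {t : M} (ht : ψ t = r • t) : t ∈ Submodule.span k (β '' {w | c w = r}) := by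
  rw [Module.Basis.mem_span_image]
  intro w hw
  have hcoord : β.coord w ∘ₗ ψ = c w • β.coord w := by
    refine β.ext fun v => ?_
    by_cases h : v = w <;> simp [hψ, h]
  have := LinearMap.congr_fun hcoord t
  simp only [LinearMap.comp_apply, ht, map_smul, LinearMap.smul_apply, smul_eq_mul,
    Module.Basis.coord_apply] at this
  exact (mul_right_cancel₀ (Finsupp.mem_support_iff.1 hw) this).symm

end Convolution

/-! ### Divisions as convolution inverses of the multiplications. -/

section Divisions

open WithConv

variable {k : Type*} [CommRing k] {A : Type*} [NonAssocRing A] [Module k A]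
  [Coalgebra k A]

theorem conv_eq_one_iff {f g : WithConv (A →ₗ[k] Module.End k A)} :
    f * g = 1 ↔ ∀ x y, LinearMap.mul' k (Module.End k A)
      (TensorProduct.map f.ofConv g.ofConv (Coalgebra.comul x)) y
        = Coalgebra.counit (R := k) x • y := by
  refine ⟨fun h x y => ?_, fun h => WithConv.ofConv_injective (LinearMap.ext₂ h)⟩
  exact congrArg (fun F : WithConv (A →ₗ[k] Module.End k A) => F x y) h

theorem conv_op_eq_one_iff {f g : WithConv (A →ₗ[k] (Module.End k A)ᵐᵒᵖ)} :
    f * g = 1 ↔ ∀ x y, (LinearMap.mul' k (Module.End k A)ᵐᵒᵖ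
      (TensorProduct.map f.ofConv g.ofConv (Coalgebra.comul x))).unop y
        = Coalgebra.counit (R := k) x • y := by
  refine ⟨fun h x y => ?_, fun h => WithConv.ofConv_injective (LinearMap.ext fun x =>
    MulOpposite.unop_injective (LinearMap.ext (h x)))⟩
  exact congrArg (fun F : WithConv (A →ₗ[k] (Module.End k A)ᵐᵒᵖ) => (F x).unop y) h

variable [IsScalarTower k A A] [SMulCommClass k A A]

/-- Left multiplications, as an element of the convolution algebra of maps to `End A`. -/
noncomputable def convMulLeft (k A : Type*) [CommRing k] [NonAssocRing A] [Module k A]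
    [IsScalarTower k A A] [SMulCommClass k A A] : WithConv (A →ₗ[k] Module.End k A) :=
  toConv (LinearMap.mul k A)

/-- Right multiplications, as an element of the convolution algebra of maps to `(End A)ᵐᵒᵖ`. -/
noncomputable def convMulRight (k A : Type*) [CommRing k] [NonAssocRing A] [Module k A]
    [IsScalarTower k A A] [SMulCommClass k A A] : WithConv (A →ₗ[k] (Module.End k A)ᵐᵒᵖ) :=
  toConv ((MulOpposite.opLinearEquiv k).toLinearMap ∘ₗ (LinearMap.mul k A).flip)

/-- The map `x ↦ (· / x)`, as an element of the convolution algebra of maps to `(End A)ᵐᵒᵖ`. -/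
noncomputable def convRightDiv (d : A →ₗ[k] A →ₗ[k] A) : WithConv (A →ₗ[k] (Module.End k A)ᵐᵒᵖ) :=
  toConv ((MulOpposite.opLinearEquiv k).toLinearMap ∘ₗ d.flip)

theorem conv_leftDiv_mul_eq_one_iff (d : A →ₗ[k] A →ₗ[k] A) :
    toConv (d : A →ₗ[k] Module.End k A) * convMulLeft k A = 1 ↔
      ∀ x y : A, TensorProduct.lift (d.compl₂ (LinearMap.mulRight k y)) (Coalgebra.comul x) =
        Coalgebra.counit (R := k) x • y := by
  rw [conv_eq_one_iff]
  refine forall₂_congr fun x y => Eq.congr ?_ rfl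
  induction Coalgebra.comul (R := k) x using TensorProduct.induction_on with
  | zero => simp
  | add s t hs ht => simp only [map_add, LinearMap.add_apply, hs, ht]
  | tmul a b => simp [convMulLeft]

theorem conv_mul_leftDiv_eq_one_iff (d : A →ₗ[k] A →ₗ[k] A) :
    convMulLeft k A * toConv (d : A →ₗ[k] Module.End k A) = 1 ↔
      ∀ x y : A, TensorProduct.lift ((LinearMap.mul k A).compl₂ (d.flip y)) (Coalgebra.comul x) =
        Coalgebra.counit (R := k) x • y := by
  rw [conv_eq_one_iff]
  refine forall₂_congr fun x y => Eq.congr ?_ rfl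
  induction Coalgebra.comul (R := k) x using TensorProduct.induction_on with
  | zero => simp
  | add s t hs ht => simp only [map_add, LinearMap.add_apply, hs, ht]
  | tmul a b => simp [convMulLeft]

/-- In `(y x₁) / x₂` the operator attached to `x₁` acts first, which is why the opposite
endomorphism algebra is needed for right divisions. -/
theorem conv_mul_rightDiv_eq_one_iff (d : A →ₗ[k] A →ₗ[k] A) :
    convMulRight k A * convRightDiv d = 1 ↔
      ∀ x y : A, TensorProduct.lift (d ∘ₗ LinearMap.mulLeft k y) (Coalgebra.comul x) =
        Coalgebra.counit (R := k) x • y := by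
  rw [conv_op_eq_one_iff]
  refine forall₂_congr fun x y => Eq.congr ?_ rfl
  induction Coalgebra.comul (R := k) x using TensorProduct.induction_on with
  | zero => simp
  | add s t hs ht => simp only [map_add, MulOpposite.unop_add, LinearMap.add_apply, hs, ht]
  | tmul a b => simp [convMulRight, convRightDiv]

theorem conv_rightDiv_mul_eq_one_iff (d : A →ₗ[k] A →ₗ[k] A) :
    convRightDiv d * convMulRight k A = 1 ↔
      ∀ x y : A, TensorProduct.lift (LinearMap.mul k A ∘ₗ d y) (Coalgebra.comul x) =
        Coalgebra.counit (R := k) x • y := by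
  rw [conv_op_eq_one_iff]
  refine forall₂_congr fun x y => Eq.congr ?_ rfl
  induction Coalgebra.comul (R := k) x using TensorProduct.induction_on with
  | zero => simp
  | add s t hs ht => simp only [map_add, MulOpposite.unop_add, LinearMap.add_apply, hs, ht]
  | tmul a b => simp [convMulRight, convRightDiv]

end Divisions

/-! ### Existence and uniqueness of the braided Hopf structure over a generating space. -/

section HopfStructures

open WithConv

theorem coalgebra_ext {k A : Type*} [CommSemiring k] [AddCommMonoid A] [Module k A]
    {C C' : Coalgebra k A} (hcomul : C.comul = C'.comul) (hcounit : C.counit = C'.counit) :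
    C = C' := by
  obtain @⟨⟨c, e⟩, _, _, _⟩ := C
  obtain @⟨⟨c', e'⟩, _, _, _⟩ := C'
  obtain rfl : c = c' := hcomul
  obtain rfl : e = e' := hcounit
  rfl

variable {k : Type*} [Field k] {A : Type*} [NonAssocRing A] [Module k A]
  [IsScalarTower k A A] [SMulCommClass k A A] {V : Type*} [AddCommMonoid V] [Module k V]
  {ι : V →ₗ[k] A} {σ : A ⊗[k] A →ₗ[k] A ⊗[k] A}

/-- The divisions of a braided nonassociative Hopf algebra are determined by its coalgebra
structure. -/
theorem BraidedHopfStructure.eq_of_toCoalgebra_eq {H H' : BraidedHopfStructure k A σ}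
    (h : H.toCoalgebra = H'.toCoalgebra) : H = H' := by
  obtain ⟨C, _, _, _, _, _, _, _, _, _, ldiv, rdiv, hlm, _, _, hrm⟩ := H
  obtain ⟨C', _, _, _, _, _, _, _, _, _, ldiv', rdiv', _, hml', hmr', _⟩ := H'
  obtain rfl : C = C' := h
  have hl : ldiv = ldiv' := by
    have h1 := (conv_leftDiv_mul_eq_one_iff ldiv).2 hlm
    have h2 := (conv_mul_leftDiv_eq_one_iff ldiv').2 hml'
    -- A left inverse from one structure meets a right inverse from the other in an associative
    -- convolution algebra.
    exact toConv_injective (left_inv_eq_right_inv h1 h2)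
  have hr : rdiv = rdiv' := by
    have h1 := (conv_rightDiv_mul_eq_one_iff rdiv).2 hrm
    have h2 := (conv_mul_rightDiv_eq_one_iff rdiv').2 hmr'
    have h3 := toConv_injective (left_inv_eq_right_inv h1 h2)
    refine LinearMap.ext₂ fun x y => ?_
    exact congrArg (fun F : A →ₗ[k] (Module.End k A)ᵐᵒᵖ => (F y).unop x) h3
  subst hl hr
  rfl

theorem BraidedHopfStructure.isPrimitiveComul (H : BraidedHopfStructure k A σ)
    (h : ∀ v, H.IsPrimitive (ι v)) : IsPrimitiveComul ι σ H.comul :=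
  ⟨H.comul_one, H.comul_mul, h⟩

/-- The counit law on a primitive element gives `ε(v) ⊗ 1 = 0`; a second application of `ε`, with
`ε(1) = 1`, forces `ε(v) = 0`. So the counit too is determined on generators. -/
theorem BraidedHopfStructure.isAugmentation (H : BraidedHopfStructure k A σ)
    (h : ∀ v, H.IsPrimitive (ι v)) : IsAugmentation ι H.counit := by
  refine ⟨H.counit_one, H.counit_mul, fun v => ?_⟩
  have h1 := LinearMap.congr_fun H.rTensor_counit_comp_comul (ι v)
  have h2 : H.comul (ι v) = ι v ⊗ₜ 1 + 1 ⊗ₜ ι v := h v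
  rw [LinearMap.comp_apply, h2, map_add, LinearMap.rTensor_tmul, LinearMap.rTensor_tmul,
    H.counit_one, TensorProduct.mk_apply, add_eq_right] at h1
  simpa [H.counit_one] using congrArg (fun t => H.counit (TensorProduct.lid k A t)) h1

variable {W : Type*} {Δ : A →ₗ[k] A ⊗[k] A} {ε : A →ₗ[k] k}
  {ρ : A →ₗ[k] V →ₗ[k] A ⊗[k] V} {ρ' : A →ₗ[k] V →ₗ[k] V ⊗[k] A}

/-- The coproduct respects the degrees of a basis that are detected by an algebra endomorphism
doubling the generators. -/
theorem IsPrimitiveComul.mem_span [CharZero k] (hι : Generates ι) (hσ : IsMulBraiding σ)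
    (hΔ : IsPrimitiveComul ι σ Δ) (hρσ : ∀ a v, σ (ι v ⊗ₜ a) = ι.lTensor A (ρ a v))
    (hρσ' : ∀ a v, σ (a ⊗ₜ ι v) = ι.rTensor A (ρ' a v)) (β : Module.Basis W k A) (deg : W → ℕ)
    {φ : A →ₗ[k] A} (h1 : φ 1 = 1) (hmul : ∀ a b, φ (a * b) = φ a * φ b)
    (hφ : ∀ v, φ (ι v) = (2 : k) • ι v) (hβ : ∀ w, φ (β w) = (2 : k) ^ deg w • β w) (w : W) :
    Δ (β w) ∈ Submodule.span k (β.tensorProduct β '' {p | deg p.1 + deg p.2 = deg w}) := by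
  -- `Δ (β w)` is an eigenvector of `φ ⊗ φ` for `2 ^ deg w`, and basis tensors have eigenvalue `2`
  -- to the total degree. Characteristic zero makes these powers of `2` distinct.
  have := mem_span_of_eigenvector (β.tensorProduct β) (ψ := TensorProduct.map φ φ)
    (c := fun p => (2 : k) ^ (deg p.1 + deg p.2)) (r := 2 ^ deg w) (t := Δ (β w)) (fun p => ?_) ?_
  · refine Submodule.span_mono (Set.image_mono fun p hp => ?_) this
    have hp' : (2 : k) ^ (deg p.1 + deg p.2) = 2 ^ deg w := hp
    exact Nat.pow_right_injective le_rfl (by exact_mod_cast hp')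
  · rw [Module.Basis.tensorProduct_apply', TensorProduct.map_tmul, hβ, hβ,
      TensorProduct.smul_tmul_smul, pow_add]
  · rw [hΔ.map_comul hι hσ hρσ hρσ' 2 h1 hmul hφ, hβ, map_smul]

theorem existsUnique_braidedHopfStructure (hι : Generates ι) (hσ : IsBraidedAlgebra k σ)
    (hρσ : ∀ a v, σ (ι v ⊗ₜ a) = ι.lTensor A (ρ a v))
    (hρσ' : ∀ a v, σ (a ⊗ₜ ι v) = ι.rTensor A (ρ' a v)) (hΔ : IsPrimitiveComul ι σ Δ)
    (hε : IsAugmentation ι ε) (β : Module.Basis W k A) (deg : W → ℕ)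
    (hdeg : ∀ w, Δ (β w) ∈
      Submodule.span k (β.tensorProduct β '' {p | deg p.1 + deg p.2 = deg w}))
    (hone : ∀ w, deg w = 0 → β w = 1) :
    ∃! H : BraidedHopfStructure k A σ, ∀ v, H.IsPrimitive (ι v) := by
  obtain ⟨hb, hm⟩ := (isBraidedAlgebra_iff σ).1 hσ
  let C : Coalgebra k A :=
    { comul := Δ
      counit := ε
      coassoc := hΔ.coassoc hι hm hb hρσ hρσ'
      rTensor_counit_comp_comul := hΔ.rTensor_counit hι hm hε hρσ'
      lTensor_counit_comp_comul := hΔ.lTensor_counit hι hm hε hρσ }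
  have hcounit : ∀ w, deg w = 0 → Coalgebra.counit (R := k) (β w) = (1 : k) := fun w hw => by
    rw [hone w hw]
    exact hε.one
  -- A basis vector of degree zero is `1`, so its left multiplication is the identity, as the
  -- convolution unit requires.
  obtain ⟨l, hl, hl'⟩ := exists_conv_inverse β deg hdeg (convMulLeft k A) fun w hw => by
    refine LinearMap.ext fun y => ?_
    change β w * y = algebraMap k (Module.End k A) (Coalgebra.counit (β w)) y
    rw [hcounit w hw, hone w hw, one_mul, map_one]
    rfl
  obtain ⟨r, hr, hr'⟩ := exists_conv_inverse β deg hdeg (convMulRight k A) fun w hw => by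
    refine MulOpposite.unop_injective (LinearMap.ext fun y => ?_)
    change y * β w = (algebraMap k (Module.End k A)ᵐᵒᵖ (Coalgebra.counit (β w))).unop y
    rw [hcounit w hw, hone w hw, mul_one, map_one]
    rfl
  let ldiv : A →ₗ[k] A →ₗ[k] A := l.ofConv
  let rdiv : A →ₗ[k] A →ₗ[k] A :=
    ((MulOpposite.opLinearEquiv k).symm.toLinearMap ∘ₗ r.ofConv : A →ₗ[k] Module.End k A).flip
  have hrdiv : r = convRightDiv rdiv := by
    refine WithConv.ofConv_injective (LinearMap.ext fun x => MulOpposite.unop_injective ?_)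
    rfl
  rw [hrdiv] at hr hr'
  refine ⟨{ toCoalgebra := C
            braidedAlgebra := hσ
            counit_braid_left := fun a b => ?_
            counit_braid_right := fun a b => ?_
            comul_braid_right := ?_
            comul_braid_left := ?_
            comul_one := hΔ.one
            comul_mul := hΔ.mul
            counit_one := hε.one
            counit_mul := hε.mul
            ldiv := ldiv
            rdiv := rdiv
            ldiv_mul := (conv_leftDiv_mul_eq_one_iff ldiv).1 hl
            mul_ldiv := (conv_mul_leftDiv_eq_one_iff ldiv).1 hl'
            mul_rdiv := (conv_mul_rightDiv_eq_one_iff rdiv).1 hr'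
            rdiv_mul := (conv_rightDiv_mul_eq_one_iff rdiv).1 hr }, hΔ.prim, fun H hH => ?_⟩
  · exact (congrArg (TensorProduct.lid k A) (hε.rTensor_braid hι hm hρσ' a b)).trans (by rfl)
  · exact (congrArg (TensorProduct.rid k A) (hε.lTensor_braid hι hm hρσ a b)).trans (by rfl)
  · exact TensorProduct.ext' fun a b => hΔ.lTensor_braid hι hm hb hρσ a b
  · exact TensorProduct.ext' fun a b => hΔ.rTensor_braid hι hm hb hρσ' a b
  · exact BraidedHopfStructure.eq_of_toCoalgebra_eq (coalgebra_ext
      ((H.isPrimitiveComul hH).unique hι hΔ) ((H.isAugmentation hH).unique hι hε))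

end HopfStructures

/-! ### The free algebra: coproduct, augmentation and grading by word length. -/

section FreeHopf

variable {k X V : Type*} [Field k] [AddCommGroup V] [Module k V] (b : Module.Basis X k V)

/-- The universal property requires of the braided square only that `1 ⊗ 1` be a two-sided unit,
which follows from the unit axioms of the braiding. -/
theorem exists_isPrimitiveComul
    {σ : FreeNonassocAlgebra k X ⊗[k] FreeNonassocAlgebra k X →ₗ[k]
      FreeNonassocAlgebra k X ⊗[k] FreeNonassocAlgebra k X} (hσ : IsMulBraiding σ) :
    ∃ Δ, IsPrimitiveComul (incl b) σ Δ := by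
  let p : V →ₗ[k] FreeNonassocAlgebra k X ⊗[k] FreeNonassocAlgebra k X :=
    (TensorProduct.mk k _ _).flip 1 ∘ₗ incl b + TensorProduct.mk k _ _ 1 ∘ₗ incl b
  exact ⟨freeLift (TensorProduct.curry (braidedMul σ)) (1 ⊗ₜ 1) (p ∘ b), freeLift_one _ _ _,
    freeLift_mul _ _ _ hσ.braidedMul_one_left hσ.braidedMul_one_right, freeLift_incl b _ _ _⟩

theorem exists_isAugmentation : ∃ ε, IsAugmentation (k := k) (incl b) ε :=
  ⟨freeLift (LinearMap.mul k k) 1 ((0 : V →ₗ[k] k) ∘ b), freeLift_one _ _ _,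
    freeLift_mul _ _ _ one_mul mul_one, freeLift_incl b _ _ _⟩

/-- The number of letters of a nonassociative word. -/
def wordDegree : WithOne (FreeMagma X) → ℕ :=
  WithOne.recOneCoe 0 FreeMagma.length

theorem single_eq_one_of_wordDegree {w : WithOne (FreeMagma X)} (hw : wordDegree w = 0) :
    (MonoidAlgebra.single w 1 : FreeNonassocAlgebra k X) = 1 := by
  cases w using WithOne.recOneCoe with
  | one => exact MonoidAlgebra.one_def.symm
  | coe w => exact absurd hw w.length_pos.ne'

/-- The endomorphism of the free nonassociative algebra that doubles the generators. -/
noncomputable def doubling (k X : Type*) [Field k] :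
    FreeNonassocAlgebra k X →ₗ[k] FreeNonassocAlgebra k X :=
  freeLift (LinearMap.mul k _) 1 fun x => (2 : k) • gen k x

theorem doubling_incl (v : V) : doubling k X (incl b v) = (2 : k) • incl b v := by
  rw [doubling, ← LinearMap.smul_apply, ← freeLift_incl b _ 1 ((2 : k) • incl b)]
  congr 2
  ext1 x
  simp [incl_basis]

theorem doubling_single (w : WithOne (FreeMagma X)) :
    doubling k X (MonoidAlgebra.single w 1) = (2 : k) ^ wordDegree w • MonoidAlgebra.single w 1 := by
  rw [doubling, freeLift_single]
  cases w using WithOne.recOneCoe with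
  | one => simp [wordLift, wordDegree, MonoidAlgebra.one_def]
  | coe w =>
    induction w with
    | ih1 x => exact congrArg (· • gen k x) (pow_one (2 : k)).symm
    | ih2 u v hu hv =>
      refine (congrArg₂ (· * ·) hu hv).trans ?_
      rw [smul_mul_smul_comm, MonoidAlgebra.single_mul_single, mul_one, ← pow_add]
      rfl

theorem IsBraidedExtension.existsUnique_braidedHopfStructure [CharZero k]
    {τ : V ⊗[k] V →ₗ[k] V ⊗[k] V}
    {σ : FreeNonassocAlgebra k X ⊗[k] FreeNonassocAlgebra k X →ₗ[k]
      FreeNonassocAlgebra k X ⊗[k] FreeNonassocAlgebra k X} (h : IsBraidedExtension b τ σ) :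
    ∃! H : BraidedHopfStructure k (FreeNonassocAlgebra k X) σ, ∀ v, H.IsPrimitive (incl b v) := by
  have hι := generates_incl b
  have hm := h.isMulBraiding
  obtain ⟨ρ, ρ', hρ, hρι, hρ', hρι'⟩ := exists_crossings b τ
  obtain ⟨Δ, hΔ⟩ := exists_isPrimitiveComul b hm
  obtain ⟨ε, hε⟩ := exists_isAugmentation b
  have hρσ := hm.incl_tmul hι h.apply_incl hρ hρι
  have hρσ' := hm.tmul_incl hι h.apply_incl hρ' hρι'
  refine BraidedNA.existsUnique_braidedHopfStructure hι h.braidedAlgebra hρσ hρσ' hΔ hε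
    (MonoidAlgebra.basis (WithOne (FreeMagma X)) k) wordDegree
    (hΔ.mem_span hι hm hρσ hρσ' _ _ (φ := doubling k X) (freeLift_one _ _ _)
      (freeLift_mul _ _ _ one_mul mul_one) (doubling_incl b) fun w => ?_) fun w hw => ?_
  · rw [MonoidAlgebra.basis_apply, doubling_single]
  · rw [MonoidAlgebra.basis_apply, single_eq_one_of_wordDegree hw]

/-- Primitivity is a linear condition, so the basis `X` can stand for all of `V`, the form that the
general argument uses. -/
theorem BraidedHopfStructure.isPrimitive_incl_iff
    {σ : FreeNonassocAlgebra k X ⊗[k] FreeNonassocAlgebra k X →ₗ[k]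
      FreeNonassocAlgebra k X ⊗[k] FreeNonassocAlgebra k X}
    (H : BraidedHopfStructure k (FreeNonassocAlgebra k X) σ) :
    (∀ v, H.IsPrimitive (incl b v)) ↔ ∀ x, H.IsPrimitive (gen k x) := by
  refine ⟨fun h x => incl_basis b x ▸ h (b x), fun h v => ?_⟩
  have key : H.comul ∘ₗ incl b =
      (TensorProduct.mk k _ _).flip 1 ∘ₗ incl b + TensorProduct.mk k _ _ 1 ∘ₗ incl b :=
    b.ext fun x => by
      rw [LinearMap.comp_apply, incl_basis, LinearMap.add_apply, LinearMap.comp_apply,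
        LinearMap.comp_apply, incl_basis]
      exact h x
  exact LinearMap.congr_fun key v

end FreeHopf

end BraidedNA

theorem theorem5p1 {k X V : Type*} [Field k] [CharZero k] [AddCommGroup V] [Module k V]
    (b : Module.Basis X k V) (τ : V ⊗[k] V →ₗ[k] V ⊗[k] V) (hτ : BraidedNA.IsBraiding τ) :
    (∃! σ : BraidedNA.FreeNonassocAlgebra k X ⊗[k] BraidedNA.FreeNonassocAlgebra k X →ₗ[k]
        BraidedNA.FreeNonassocAlgebra k X ⊗[k] BraidedNA.FreeNonassocAlgebra k X,
      BraidedNA.IsBraidedExtension b τ σ) ∧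
    ∀ σ : BraidedNA.FreeNonassocAlgebra k X ⊗[k] BraidedNA.FreeNonassocAlgebra k X →ₗ[k]
        BraidedNA.FreeNonassocAlgebra k X ⊗[k] BraidedNA.FreeNonassocAlgebra k X,
      BraidedNA.IsBraidedExtension b τ σ →
      ∃! H : BraidedNA.BraidedHopfStructure k (BraidedNA.FreeNonassocAlgebra k X) σ,
        ∀ x : X, H.IsPrimitive (BraidedNA.gen k x) := by
  refine ⟨BraidedNA.existsUnique_isBraidedExtension b hτ, fun σ h => ?_⟩
  simpa only [BraidedNA.BraidedHopfStructure.isPrimitive_incl_iff] using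
    h.existsUnique_braidedHopfStructure b
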